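/- For $k\ge 1$ let $$\mathcal B_k=\Big\{M\in\mathbb R^{k\times k}: M_{i,j}\ge 0,\ \sum_{j}M_{i,j}=1\ \forall i,\ \sum_{i}M_{i,j}=1\ \forall j\Big\},\qquad \mathcal S_k=\Big\{M\in\mathbb R^{k\times k}: M_{i,j}\ge 0,\ \sum_{j}M_{i,j}\le 1\ \forall i,\ \sum_{i}M_{i,j}\le 1\ \forall j\Big\}$$ be the Birkhoff and the sub-Birkhoff polytope. Let $\operatorname{vol}(\mathcal S_k)$ be the $k^2$-dimensional Lebesgue measure of $\mathcal S_k$, let $\operatorname{vol}(\mathcal B_k)$ be the $(k-1)^2$-dimensional Euclidean volume of $\mathcal B_k$ inside its affine hull in $\mathbb R^{k\times k}$ (with the Frobenius norm), and for $t\in\mathbb N$ let $L(t,P)=\#(\mathbb Z^{k\times k}\cap tP)$. For $n\ge 2$ and $x\in\mathbb R^n$ put $$h_{1,\infty}(x_1,\dots,x_n)=\int_{\mathbb R}e^{i\pi(n-2)y}\prod_{j=1}^n\operatorname{sinc}\big(\pi(y+x_j)\big)\,dy,\qquad \Delta(x_1,\dots,x_n)=\prod_{1\le i<j\le n}(x_i-x_j),$$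 where $\operatorname{sinc}(u)=\sin(u)/u$ and $\operatorname{sinc}(0)=1$. (1) For every integer $k\ge 1$, $$\operatorname{vol}(\mathcal S_k)=\lim_{t\to\infty}\frac{L(t,\mathcal S_k)}{t^{k^2}}=\frac{(2\pi)^{k(k-1)}}{k!}\int_{\mathbb R^k}\big|h_{1,\infty}(0,x_1,\dots,x_k)\big|^{2k}\,\Delta(x_1,\dots,x_k)^2\,dx_1\cdots dx_k .$$ (2) For every integer $k\ge 2$, $$\frac{\operatorname{vol}(\mathcal B_k)}{k^{k-1}}=\lim_{t\to\infty}\frac{L(t,\mathcal B_k)}{t^{(k-1)^2}}=\frac{(2\pi)^{k(k-1)}}{k!}\int_{\mathbb R^{k-1}}\big|h_{1,\infty}(0,x_2,\dots,x_k)\big|^{2k}\,\Delta(0,x_2,\dots,x_k)^2\,dx_2\cdots dx_k .$$ Both integrands are integrable. -/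

import Mathlib

open MeasureTheory Filter Topology
open scoped Pointwise

noncomputable section

/-- Real `k × k` matrices as a Euclidean space: the norm is the Frobenius norm, `volume` is
Lebesgue measure in the `k ^ 2` entries. -/
abbrev MatSpace (k : ℕ) : Type := EuclideanSpace ℝ (Fin k × Fin k)

/-- The Birkhoff polytope: nonnegative `k × k` matrices all of whose row sums and column sums
are equal to `1`. -/
def birkhoffPolytope (k : ℕ) : Set (MatSpace k) :=
  {M | (∀ i j, 0 ≤ M (i, j)) ∧ (∀ i, ∑ j, M (i, j) = 1) ∧ (∀ j, ∑ i, M (i, j) = 1)}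

/-- The sub-Birkhoff polytope: nonnegative `k × k` matrices all of whose row sums and column sums
are at most `1`. -/
def subBirkhoffPolytope (k : ℕ) : Set (MatSpace k) :=
  {M | (∀ i j, 0 ≤ M (i, j)) ∧ (∀ i, ∑ j, M (i, j) ≤ 1) ∧ (∀ j, ∑ i, M (i, j) ≤ 1)}

/-- `birkhoffPolytope k` consists of Mathlib's doubly stochastic matrices. -/
theorem mem_birkhoffPolytope_iff {k : ℕ} (M : MatSpace k) :
    M ∈ birkhoffPolytope k ↔
      (Matrix.of fun i j => M (i, j)) ∈ doublyStochastic ℝ (Fin k) := by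
  simp [birkhoffPolytope, mem_doublyStochastic_iff_sum]

/-- The Ehrhart function `L(t, P) = #(ℤ^(k × k) ∩ t P)`. -/
def ehrhart {k : ℕ} (t : ℕ) (P : Set (MatSpace k)) : ℕ :=
  Set.ncard {A : Fin k × Fin k → ℤ | WithLp.toLp 2 (fun p => (A p : ℝ)) ∈ (t : ℝ) • P}

/-- The volume of the Birkhoff polytope: the `(k - 1) ^ 2`-dimensional Euclidean volume in its
affine hull, i.e. the Hausdorff measure normalised to agree with Lebesgue measure on Euclidean
spaces of dimension `(k - 1) ^ 2`. -/
def volBirkhoff (k : ℕ) : ℝ :=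
  ((Measure.euclideanHausdorffMeasure ((k - 1) ^ 2) : Measure (MatSpace k))
    (birkhoffPolytope k)).toReal

/-- The volume of the sub-Birkhoff polytope: Lebesgue measure in the `k ^ 2` entries. -/
def volSubBirkhoff (k : ℕ) : ℝ :=
  ((volume : Measure (MatSpace k)) (subBirkhoffPolytope k)).toReal

/-- The limiting homogeneous complete symmetric function
`h_{c,∞}(x₁, …, xₙ) = cⁿ ∫_ℝ e^{iπc(n-2)y} ∏ⱼ sinc(πc(y + xⱼ)) dy`, for `n ≥ 2`. -/
def hInfty {n : ℕ} (c : ℝ) (x : Fin n → ℝ) : ℂ :=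
  (c : ℂ) ^ n * ∫ y : ℝ,
    Complex.exp (Complex.I * (Real.pi * c * ((n : ℝ) - 2) * y : ℝ)) *
      ((∏ j, Real.sinc (Real.pi * c * (y + x j)) : ℝ) : ℂ)

/-- The Vandermonde product `Δ(x₁, …, xₙ) = ∏_{i < j} (xᵢ - xⱼ)`. -/
def vandermondeProd {n : ℕ} (x : Fin n → ℝ) : ℝ :=
  ∏ i, ∏ j ∈ Finset.Ioi i, (x i - x j)

/-- The integrand `|h_{1,∞}(0, x₁, …, x_k)|^{2k} Δ(x₁, …, x_k)²` on `ℝ^k`. -/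
def subBirkhoffDensity (k : ℕ) (x : Fin k → ℝ) : ℝ :=
  ‖hInfty 1 (Fin.cons 0 x : Fin (k + 1) → ℝ)‖ ^ (2 * k) * vandermondeProd x ^ 2

/-- The integrand `|h_{1,∞}(0, x₂, …, x_k)|^{2k} Δ(0, x₂, …, x_k)²` on `ℝ^(k-1)`. -/
def birkhoffDensity (k : ℕ) (x : Fin (k - 1) → ℝ) : ℝ :=
  ‖hInfty 1 (Fin.cons 0 x : Fin (k - 1 + 1) → ℝ)‖ ^ (2 * k) *
    vandermondeProd (Fin.cons 0 x : Fin (k - 1 + 1) → ℝ) ^ 2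

end

noncomputable section

/-! ### Symmetric polynomials: the pairing that extracts coefficients -/

open MvPolynomial

/-! Write `H_t = h_0 + … + h_t`. Reading a matrix row by row as exponent vectors, the lattice points
of `t S_k` are counted by the coefficients of `H_t ^ k` at exponents in `[0, t] ^ k`, and those of
`t B_k` by the coefficient of `h_t ^ k` at `(t, …, t)`. For symmetric `f` and the pairing that makes
monomials orthonormal, `⟨f Δ, (∏ h_{c_i}) Δ⟩ = k! [x^c] f` (`coeffPairing_prod_completeHomog`). With
`f = H_t ^ k` or `h_t ^ k`, Parseval turns `k!` times the count into a torus integral of `|H_t| ^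
(2k) |Δ| ^ 2`. In the homogeneous case one variable is set to `1`, and `h_t(1, x) = H_t(x)`.

Put `θ = x / t`. Then `H_t / t ^ d` is a Riemann sum for the Fourier transform of the solid simplex,
whose modulus is `|h_{1,∞}(0, x)|` by Fourier inversion (`norm_hInfty_cons_zero`), while `t ^
(k(k-1)/2) |Δ|` tends to a power of `2π` times the real Vandermonde product. So the integrands
converge pointwise to the stated density, up to the constant. The counts divided by `t ^ D` converge
because the polytopes are compact and convex.

The exchange of limit and integral is the delicate point (`integrable_and_integral_limitDensity`).
Fatou gives integrability and one inequality. For the other, mass must be kept from escaping to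
infinity. One copy of the polynomial is multiplied by a product `G` of Dirichlet-type kernels of
length `M ≈ ε t`. Since all coefficients are nonnegative, the pairing is at least `G(1)` times the
term for `t - q M`. By the inequality of arithmetic and geometric means it is at most `G(1)` times
half the plain moment plus half a damped moment, and dominated convergence applies to the latter.
With `v` the limit of the normalised counts, `K = k!` and `I` the limit integral, this gives `K v (1
- q ε) ^ D ≤ K v / 2 + I / 2`, and `ε → 0` gives `K v ≤ I`.

For the Birkhoff polytope, deleting a row and a column is a bijection on lattice points, and its
inverse scales volume by `k ^ (k - 1)`, the square root of a Gram determinant. -/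

/-- The complete homogeneous symmetric polynomial of degree `n` as a sum of monomials. -/
def completeHomog (k n : ℕ) : MvPolynomial (Fin k) ℤ :=
  ∑ a ∈ (Finset.univ : Finset (Fin k)).finsuppAntidiag n, monomial a 1

/-- The complete homogeneous symmetric polynomial of degree `n - m`, zero for `n < m`. -/
def shiftedCompleteHomog (k n m : ℕ) : MvPolynomial (Fin k) ℤ :=
  if m ≤ n then completeHomog k (n - m) else 0

/-- The Vandermonde determinant in the polynomial ring. -/
def vandermondePoly (k : ℕ) : MvPolynomial (Fin k) ℤ :=
  (Matrix.of fun i j : Fin k => (X j : MvPolynomial (Fin k) ℤ) ^ (i : ℕ)).det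

/-- The bilinear form on polynomials for which monomials are orthonormal. -/
def coeffPairing {k : ℕ} (P : MvPolynomial (Fin k) ℤ) : MvPolynomial (Fin k) ℤ →ₗ[ℤ] ℤ where
  toFun Q := ∑ a ∈ P.support, coeff a P * coeff a Q
  map_add' Q R := by simp [mul_add, Finset.sum_add_distrib]
  map_smul' r Q := by
    simp only [coeff_smul, smul_eq_mul, Finset.mul_sum, mul_left_comm, RingHom.id_apply]

theorem coeffPairing_monomial {k : ℕ} (P : MvPolynomial (Fin k) ℤ) (a : Fin k →₀ ℕ) :
    coeffPairing P (monomial a 1) = coeff a P := by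
  classical
  simp only [coeffPairing, LinearMap.coe_mk, AddHom.coe_mk, coeff_monomial, mul_ite, mul_one,
    mul_zero, Finset.sum_ite_eq]
  split_ifs with h
  · rfl
  · exact (notMem_support_iff.mp h).symm

theorem geomSeries_mul_one_sub {R : Type*} [CommRing R] (x : R) :
    PowerSeries.mk (fun n => x ^ n) * (1 - PowerSeries.C x * PowerSeries.X) = 1 := by
  ext n
  rw [mul_sub, mul_one, ← mul_assoc, mul_comm _ (PowerSeries.C x), mul_assoc, map_sub,
    PowerSeries.coeff_C_mul]
  cases n with
  | zero => simp
  | succ n => simp [PowerSeries.coeff_succ_mul_X, pow_succ', PowerSeries.coeff_one]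

theorem coeff_prod_geomSeries (k n : ℕ) :
    PowerSeries.coeff n (∏ l : Fin k, PowerSeries.mk
      (fun m => (X l : MvPolynomial (Fin k) ℤ) ^ m)) = completeHomog k n := by
  rw [PowerSeries.coeff_prod, completeHomog]
  refine Finset.sum_congr rfl fun a _ => ?_
  simp only [PowerSeries.coeff_mk]
  rw [monomial_eq, Finsupp.prod_fintype _ _ (by simp)]
  simp

/-- The power series `∏_{l ≠ j} (1 - X_l Y)`. -/
def omittedProduct (k : ℕ) (j : Fin k) : PowerSeries (MvPolynomial (Fin k) ℤ) :=
  ∏ l ∈ Finset.univ.erase j, (1 - PowerSeries.C (X l) * PowerSeries.X)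

theorem coeff_prod_one_sub_eq_zero {R ι : Type*} [CommRing R] (s : Finset ι) (x : ι → R) {m : ℕ}
    (hm : s.card < m) :
    PowerSeries.coeff m (∏ l ∈ s, (1 - PowerSeries.C (x l) * PowerSeries.X)) = 0 := by
  classical
  induction s using Finset.induction_on generalizing m with
  | empty =>
    simp only [Finset.card_empty] at hm
    simp [PowerSeries.coeff_one, hm.ne']
  | insert a s ha ih =>
    rw [Finset.card_insert_of_notMem ha] at hm
    obtain ⟨m, rfl⟩ : ∃ m', m = m' + 1 := ⟨m - 1, by omega⟩
    rw [Finset.prod_insert ha, sub_mul, one_mul, map_sub, ih (by omega), mul_assoc,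
      PowerSeries.coeff_C_mul, mul_comm PowerSeries.X, PowerSeries.coeff_succ_mul_X, ih (by omega)]
    simp

/-- Compare coefficients of `Y ^ n` in `1 / (1 - X_j Y) = ∏_l 1 / (1 - X_l Y) · ∏_{l ≠ j} (1 - X_l
Y)`. The last product has degree at most `k - 1` in `Y`, so `m` runs over `Fin k` only. -/
theorem X_pow_eq_sum (k n : ℕ) (j : Fin k) :
    (X j : MvPolynomial (Fin k) ℤ) ^ n =
      ∑ m : Fin k, shiftedCompleteHomog k n m * PowerSeries.coeff m (omittedProduct k j) := by
  have h1 : PowerSeries.mk (fun m => (X j : MvPolynomial (Fin k) ℤ) ^ m) =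
      (∏ l : Fin k, PowerSeries.mk (fun m => (X l : MvPolynomial (Fin k) ℤ) ^ m)) *
        omittedProduct k j := by
    rw [← Finset.mul_prod_erase _ _ (Finset.mem_univ j), omittedProduct, mul_assoc,
      ← Finset.prod_mul_distrib]
    simp [geomSeries_mul_one_sub]
  have h2 := congrArg (PowerSeries.coeff n) h1
  rw [PowerSeries.coeff_mk, PowerSeries.coeff_mul, Finset.Nat.sum_antidiagonal_eq_sum_range_succ_mk,
    ← Finset.sum_range_reflect] at h2
  rw [h2, Finset.sum_fin_eq_sum_range]
  have h3 : ∀ m ∈ Finset.range (max k (n + 1)),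
      (if h : m < k then shiftedCompleteHomog k n (⟨m, h⟩ : Fin k) *
        PowerSeries.coeff ((⟨m, h⟩ : Fin k) : ℕ) (omittedProduct k j) else 0) =
      if m < n + 1 then PowerSeries.coeff (n - m) (∏ l : Fin k, PowerSeries.mk
        (fun m => (X l : MvPolynomial (Fin k) ℤ) ^ m)) *
        PowerSeries.coeff m (omittedProduct k j) else 0 := by
    intro m _
    have hc : k ≤ m → PowerSeries.coeff m (omittedProduct k j) = 0 := fun hm =>
      coeff_prod_one_sub_eq_zero _ _ (by
        rw [Finset.card_erase_of_mem (Finset.mem_univ j), Finset.card_univ, Fintype.card_fin]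
        have := j.2
        omega)
    rw [coeff_prod_geomSeries]
    by_cases hm : m < k <;> by_cases hn : m < n + 1
    · simp [hm, hn, shiftedCompleteHomog, Nat.lt_succ_iff.mp hn]
    · simp [hm, hn, shiftedCompleteHomog, show ¬ m ≤ n by omega]
    · simp [hm, hn, hc (by omega)]
    · simp [hm, hn]
  have h4 := Finset.sum_congr rfl h3
  rw [← Finset.sum_subset (Finset.range_mono (le_max_left k (n + 1)))
      (by intro m _ hm; simp only [Finset.mem_range] at hm; simp [hm]),
    ← Finset.sum_subset (Finset.range_mono (le_max_right k (n + 1)))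
      (by intro m _ hm; simp only [Finset.mem_range] at hm; simp [hm])] at h4
  rw [h4]
  refine Finset.sum_congr rfl fun m hm => ?_
  have hm' := Finset.mem_range.mp hm
  have e1 : n + 1 - 1 - m = n - m := by omega
  have e2 : n - (n - m) = m := by omega
  rw [if_pos hm', Nat.succ_eq_add_one, e1, e2]

theorem completeHomog_zero (k : ℕ) : completeHomog k 0 = 1 := by
  simp [completeHomog]

/-- The bialternant form of the Jacobi–Trudi identity. -/
theorem det_X_pow_eq (k : ℕ) (c : Fin k → ℕ) :
    (Matrix.of fun i j : Fin k => (X j : MvPolynomial (Fin k) ℤ) ^ c i).det =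
      (Matrix.of fun i m : Fin k => shiftedCompleteHomog k (c i) m).det * vandermondePoly k := by
  have key : ∀ c : Fin k → ℕ,
      (Matrix.of fun i j : Fin k => (X j : MvPolynomial (Fin k) ℤ) ^ c i) =
      (Matrix.of fun i m : Fin k => shiftedCompleteHomog k (c i) m) *
      (Matrix.of fun m j : Fin k => PowerSeries.coeff m (omittedProduct k j)) := by
    intro c
    ext1 i j
    rw [Matrix.mul_apply]
    exact X_pow_eq_sum k (c i) j
  -- For the exponents `0, …, k - 1` the matrix of `h`'s is unitriangular, which identifies the
  -- determinant of the second factor.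
  have hE : vandermondePoly k =
      (Matrix.of fun m j : Fin k => PowerSeries.coeff m (omittedProduct k j)).det := by
    rw [vandermondePoly, key (fun i => (i : ℕ)), Matrix.det_mul,
      Matrix.det_of_isLowerTriangular]
    · simp [shiftedCompleteHomog, completeHomog_zero]
    · intro i j hij
      have : ¬ (j : ℕ) ≤ i := not_le.mpr (show i < j from hij)
      simp only [Matrix.of_apply, shiftedCompleteHomog, if_neg this]
  rw [key, Matrix.det_mul, hE]

theorem rename_vandermondePoly (k : ℕ) (σ : Equiv.Perm (Fin k)) :
    rename σ (vandermondePoly k) = (Equiv.Perm.sign σ : ℤ) • vandermondePoly k := by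
  rw [vandermondePoly, AlgHom.map_det, zsmul_eq_mul, ← Matrix.det_permute' σ]
  congr 1
  ext1 i j
  simp

/-- The exponent vector `(σ 0, σ 1, …)`. -/
def permExponent {k : ℕ} (σ : Equiv.Perm (Fin k)) : Fin k →₀ ℕ :=
  Finsupp.equivFunOnFinite.symm fun i => (σ i : ℕ)

theorem vandermondePoly_eq_sum (k : ℕ) :
    vandermondePoly k = ∑ σ : Equiv.Perm (Fin k),
      monomial (permExponent σ) (Equiv.Perm.sign σ : ℤ) := by
  rw [vandermondePoly, Matrix.det_apply']
  refine Finset.sum_congr rfl fun σ _ => ?_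
  rw [monomial_eq, Finsupp.prod_fintype _ _ (by simp)]
  simp [permExponent]

theorem coeff_symm_mul_vandermondePoly {k : ℕ} {f : MvPolynomial (Fin k) ℤ} (hf : f.IsSymmetric)
    (σ : Equiv.Perm (Fin k)) (c : Fin k →₀ ℕ) :
    coeff (c.mapDomain σ) (f * vandermondePoly k) =
      (Equiv.Perm.sign σ : ℤ) * coeff c (f * vandermondePoly k) := by
  have h := coeff_rename_mapDomain σ σ.injective (f * vandermondePoly k) c
  rw [map_mul, hf σ, rename_vandermondePoly, mul_smul_comm, coeff_smul] at h
  rw [← h, smul_eq_mul, ← mul_assoc, ← Units.val_mul, Int.units_mul_self]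
  simp

theorem det_X_pow_eq_sum (k : ℕ) (c : Fin k →₀ ℕ) :
    (Matrix.of fun i j : Fin k => (X j : MvPolynomial (Fin k) ℤ) ^ c i).det =
      ∑ σ : Equiv.Perm (Fin k), (Equiv.Perm.sign σ : ℤ) • monomial (c.mapDomain σ) 1 := by
  rw [← Matrix.det_transpose, Matrix.det_apply']
  refine Finset.sum_congr rfl fun σ _ => ?_
  rw [zsmul_eq_mul, monomial_eq, Finsupp.prod_mapDomain_index_inj σ.injective,
    Finsupp.prod_fintype _ _ (by simp)]
  simp

/-- Both arguments are alternating: the two signs of each permutation cancel, so all `k!` terms of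
the determinant contribute the same coefficient. -/
theorem coeffPairing_det {k : ℕ} {f : MvPolynomial (Fin k) ℤ} (hf : f.IsSymmetric)
    (c : Fin k →₀ ℕ) :
    coeffPairing (f * vandermondePoly k)
      (Matrix.of fun i j : Fin k => (X j : MvPolynomial (Fin k) ℤ) ^ c i).det =
      k.factorial * coeff c (f * vandermondePoly k) := by
  rw [det_X_pow_eq_sum, map_sum]
  have : ∀ σ : Equiv.Perm (Fin k), coeffPairing (f * vandermondePoly k)
      ((Equiv.Perm.sign σ : ℤ) • monomial (c.mapDomain σ) 1) =
      coeff c (f * vandermondePoly k) := by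
    intro σ
    rw [map_smul, coeffPairing_monomial, coeff_symm_mul_vandermondePoly hf, smul_eq_mul,
      ← mul_assoc, ← Units.val_mul, Int.units_mul_self]
    simp
  simp only [this, Finset.sum_const, Finset.card_univ, Fintype.card_perm, Fintype.card_fin,
    nsmul_eq_mul]

/-- The guard `permExponent σ ≤ c` is the one in the coefficient formula for multiplication by a
monomial, so the expansion can be read as a power series product in the exponent `c`. -/
theorem shiftedCompleteHomog_det {k : ℕ} (c : Fin k →₀ ℕ) :
    (Matrix.of fun i m : Fin k => shiftedCompleteHomog k (c i) m).det =
      ∑ σ : Equiv.Perm (Fin k), (Equiv.Perm.sign σ : ℤ) •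
        (if permExponent σ ≤ c then ∏ i, completeHomog k ((c - permExponent σ) i) else 0) := by
  rw [← Matrix.det_transpose, Matrix.det_apply']
  refine Finset.sum_congr rfl fun σ _ => ?_
  rw [zsmul_eq_mul]
  congr 1
  split_ifs with h
  · refine Finset.prod_congr rfl fun i _ => ?_
    have hi : (σ i : ℕ) ≤ c i := h i
    simp [shiftedCompleteHomog, hi, permExponent]
  · obtain ⟨i, hi⟩ : ∃ i, ¬ (σ i : ℕ) ≤ c i := by
      by_contra! hc
      exact h fun i => hc i
    refine Finset.prod_eq_zero (Finset.mem_univ i) ?_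
    simp [shiftedCompleteHomog, hi]

theorem permExponent_injective (k : ℕ) :
    Function.Injective (permExponent : Equiv.Perm (Fin k) → Fin k →₀ ℕ) := by
  intro σ τ h
  ext i
  exact DFunLike.congr_fun h i

/-- Against a symmetric polynomial, the product `∏ h_{c_i}` extracts the coefficient at `c`. -/
theorem coeffPairing_prod_completeHomog {k : ℕ} {f : MvPolynomial (Fin k) ℤ} (hf : f.IsSymmetric)
    (c : Fin k →₀ ℕ) :
    coeffPairing (f * vandermondePoly k)
      ((∏ i, completeHomog k (c i)) * vandermondePoly k) = k.factorial * coeff c f := by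
  -- The defect of the identity, for all `c` at once, is taken as a power series `U`; `D` is the
  -- Vandermonde determinant as a power series. Expanding `coeffPairing_det` on both sides says that
  -- every coefficient of `U * D` vanishes. Power series over `ℤ` form a domain and `D ≠ 0`, so `U =
  -- 0`.
  let U : MvPowerSeries (Fin k) ℤ := fun c => coeffPairing (f * vandermondePoly k)
      ((∏ i, completeHomog k (c i)) * vandermondePoly k) - k.factorial * coeff c f
  let D : MvPowerSeries (Fin k) ℤ := ∑ σ : Equiv.Perm (Fin k),
      MvPowerSeries.monomial (permExponent σ) (Equiv.Perm.sign σ : ℤ)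
  have hD : D ≠ 0 := by
    intro h
    have h1 := congrArg (MvPowerSeries.coeff (permExponent (1 : Equiv.Perm (Fin k)))) h
    simp only [D, map_sum, MvPowerSeries.coeff_monomial, (permExponent_injective k).eq_iff,
      Finset.sum_ite_eq, Finset.mem_univ] at h1
    simp at h1
  have hUD : U * D = 0 := by
    ext c
    have h1 := coeffPairing_det hf c
    have h2 : coeff c (f * vandermondePoly k) = ∑ σ : Equiv.Perm (Fin k),
        if permExponent σ ≤ c then coeff (c - permExponent σ) f * (Equiv.Perm.sign σ : ℤ)
        else 0 := by
      rw [vandermondePoly_eq_sum, Finset.mul_sum, coeff_sum]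
      exact Finset.sum_congr rfl fun σ _ => coeff_mul_monomial' _ _ _ _
    rw [det_X_pow_eq, shiftedCompleteHomog_det, Finset.sum_mul, map_sum, h2, Finset.mul_sum,
      ← sub_eq_zero, ← Finset.sum_sub_distrib] at h1
    rw [map_zero, ← h1]
    simp only [D, Finset.mul_sum, map_sum, MvPowerSeries.coeff_mul_monomial]
    refine Finset.sum_congr rfl fun σ _ => ?_
    rw [smul_mul_assoc, map_smul]
    split_ifs with h
    · have : MvPowerSeries.coeff (c - permExponent σ) U = U (c - permExponent σ) := rfl
      simp only [this, U, smul_eq_mul]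
      ring
    · simp only [zero_mul, map_zero, smul_zero, mul_zero, sub_zero]
  have hU : U = 0 := (mul_eq_zero.mp hUD).resolve_right hD
  exact sub_eq_zero.mp (congrFun hU c)


/-! ### Coefficientwise inequalities and the smoothing polynomials -/

open MvPolynomial

/-- The sum of the complete homogeneous symmetric polynomials of degree at most `t`. -/
def completeHomogLE (k t : ℕ) : MvPolynomial (Fin k) ℤ :=
  ∑ n ∈ Finset.range (t + 1), completeHomog k n

/-- All coefficients are nonnegative. -/
def CoeffNonneg {k : ℕ} (P : MvPolynomial (Fin k) ℤ) : Prop := ∀ a, 0 ≤ coeff a P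

namespace CoeffNonneg

variable {k : ℕ} {P Q : MvPolynomial (Fin k) ℤ}

theorem add (hP : CoeffNonneg P) (hQ : CoeffNonneg Q) : CoeffNonneg (P + Q) := fun a => by
  rw [coeff_add]
  exact add_nonneg (hP a) (hQ a)

theorem mul (hP : CoeffNonneg P) (hQ : CoeffNonneg Q) : CoeffNonneg (P * Q) := fun a => by
  classical
  rw [coeff_mul]
  exact Finset.sum_nonneg fun x _ => mul_nonneg (hP _) (hQ _)

theorem monomial (a : Fin k →₀ ℕ) : CoeffNonneg (monomial a (1 : ℤ)) := fun b => by
  classical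
  rw [coeff_monomial]
  split_ifs <;> simp

theorem one : CoeffNonneg (1 : MvPolynomial (Fin k) ℤ) := monomial 0

theorem sum {ι : Type*} {s : Finset ι} {f : ι → MvPolynomial (Fin k) ℤ}
    (h : ∀ i ∈ s, CoeffNonneg (f i)) : CoeffNonneg (∑ i ∈ s, f i) := fun a => by
  rw [coeff_sum]
  exact Finset.sum_nonneg fun i hi => h i hi a

theorem prod {ι : Type*} {s : Finset ι} {f : ι → MvPolynomial (Fin k) ℤ}
    (h : ∀ i ∈ s, CoeffNonneg (f i)) : CoeffNonneg (∏ i ∈ s, f i) := by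
  classical
  induction s using Finset.induction_on with
  | empty => simpa using one
  | insert a s ha ih =>
    rw [Finset.prod_insert ha]
    exact (h a (by simp)).mul (ih fun i hi => h i (by simp [hi]))

/-- Products are monotone for the coefficientwise order. -/
theorem prod_sub_prod {ι : Type*} {s : Finset ι} {f g : ι → MvPolynomial (Fin k) ℤ}
    (hf : ∀ i ∈ s, CoeffNonneg (f i)) (h : ∀ i ∈ s, CoeffNonneg (g i - f i)) :
    CoeffNonneg (∏ i ∈ s, g i - ∏ i ∈ s, f i) := by
  classical
  induction s using Finset.induction_on with
  | empty => simp [CoeffNonneg]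
  | insert a s ha ih =>
    have hg : ∀ i ∈ s, CoeffNonneg (g i) := fun i hi => by
      simpa using (h i (by simp [hi])).add (hf i (by simp [hi]))
    rw [Finset.prod_insert ha, Finset.prod_insert ha]
    have e : g a * ∏ i ∈ s, g i - f a * ∏ i ∈ s, f i =
        (g a - f a) * ∏ i ∈ s, g i + f a * (∏ i ∈ s, g i - ∏ i ∈ s, f i) := by ring
    rw [e]
    exact ((h a (by simp)).mul (prod hg)).add ((hf a (by simp)).mul
      (ih (fun i hi => hf i (by simp [hi])) fun i hi => h i (by simp [hi])))

end CoeffNonneg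

theorem coeffNonneg_completeHomog (k n : ℕ) : CoeffNonneg (completeHomog k n) :=
  CoeffNonneg.sum fun a _ => CoeffNonneg.monomial a

theorem coeffNonneg_completeHomogLE (k n : ℕ) : CoeffNonneg (completeHomogLE k n) :=
  CoeffNonneg.sum fun a _ => coeffNonneg_completeHomog k a

theorem coeff_completeHomog (k n : ℕ) (a : Fin k →₀ ℕ) :
    coeff a (completeHomog k n) = if ∑ i, a i = n then 1 else 0 := by
  classical
  simp [completeHomog, coeff_sum, coeff_monomial, Finset.mem_finsuppAntidiag]

theorem isSymmetric_completeHomog (k n : ℕ) : (completeHomog k n).IsSymmetric := by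
  intro σ
  ext a
  have h := coeff_rename_mapDomain σ σ.injective (completeHomog k n) (a.mapDomain σ.symm)
  rw [← Finsupp.mapDomain_comp, Equiv.self_comp_symm, Finsupp.mapDomain_id] at h
  rw [h, coeff_completeHomog, coeff_completeHomog]
  congr 2
  have : ∀ i, Finsupp.mapDomain σ.symm a i = a (σ i) := fun i => by
    conv_lhs => rw [← Equiv.symm_apply_apply σ i]
    exact Finsupp.mapDomain_apply σ.symm.injective _ _
  simp only [this]
  exact Equiv.sum_comp σ _

theorem MvPolynomial.IsSymmetric.pow {k : ℕ} {f : MvPolynomial (Fin k) ℤ} (h : f.IsSymmetric)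
    (n : ℕ) : (f ^ n).IsSymmetric := fun σ => by
  rw [map_pow, h σ]

theorem isSymmetric_completeHomogLE (k n : ℕ) : (completeHomogLE k n).IsSymmetric := fun σ => by
  rw [completeHomogLE, map_sum]
  exact Finset.sum_congr rfl fun i _ => isSymmetric_completeHomog k i σ

/-- The sum of the coefficients at exponents at most `(t, …, t)`. -/
def boxCoeffSum {k : ℕ} (t : ℕ) (P : MvPolynomial (Fin k) ℤ) : ℤ :=
  ∑ c ∈ Fintype.piFinset (fun _ : Fin k => Finset.range (t + 1)),
    coeff (Finsupp.equivFunOnFinite.symm c) P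

/-- `(h_0 + … + h_t) ^ k` expands into the products `∏ h_{c_i}` with `c` in the box, and each of
them extracts one coefficient. -/
theorem coeffPairing_completeHomogLE {k : ℕ} {f : MvPolynomial (Fin k) ℤ} (hf : f.IsSymmetric)
    (t : ℕ) :
    coeffPairing (f * vandermondePoly k) (completeHomogLE k t ^ k * vandermondePoly k) =
      k.factorial * boxCoeffSum t f := by
  have h : completeHomogLE k t ^ k =
      ∑ c ∈ Fintype.piFinset (fun _ : Fin k => Finset.range (t + 1)),
        ∏ i, completeHomog k (c i) := by
    rw [← Finset.prod_univ_sum, Finset.prod_const, Finset.card_univ, Fintype.card_fin,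
      completeHomogLE]
  rw [h, Finset.sum_mul, map_sum, boxCoeffSum, Finset.mul_sum]
  exact Finset.sum_congr rfl fun c _ =>
    coeffPairing_prod_completeHomog hf (Finsupp.equivFunOnFinite.symm c)

theorem coeffPairing_completeHomog_pow {k : ℕ} {f : MvPolynomial (Fin k) ℤ} (hf : f.IsSymmetric)
    (t : ℕ) :
    coeffPairing (f * vandermondePoly k) (completeHomog k t ^ k * vandermondePoly k) =
      k.factorial * coeff (Finsupp.equivFunOnFinite.symm fun _ => t) f := by
  rw [← coeffPairing_prod_completeHomog hf]
  simp

theorem boxCoeffSum_sub {k : ℕ} (t : ℕ) (P Q : MvPolynomial (Fin k) ℤ) :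
    boxCoeffSum t (P - Q) = boxCoeffSum t P - boxCoeffSum t Q := by
  simp [boxCoeffSum]

theorem boxCoeffSum_nonneg {k : ℕ} (t : ℕ) {P : MvPolynomial (Fin k) ℤ} (hP : CoeffNonneg P) :
    0 ≤ boxCoeffSum t P :=
  Finset.sum_nonneg fun _ _ => hP _

theorem boxCoeffSum_le_mul_monomial {k s t : ℕ} {P : MvPolynomial (Fin k) ℤ} (hP : CoeffNonneg P)
    {v : Fin k →₀ ℕ} (hv : ∀ i, s + v i ≤ t) :
    boxCoeffSum s P ≤ boxCoeffSum t (P * monomial v 1) := by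
  classical
  have e : ∀ c : Fin k → ℕ, coeff (Finsupp.equivFunOnFinite.symm c) P =
      coeff (Finsupp.equivFunOnFinite.symm (c + ⇑v)) (P * monomial v 1) := by
    intro c
    have : (Finsupp.equivFunOnFinite.symm (c + ⇑v) : Fin k →₀ ℕ) =
        Finsupp.equivFunOnFinite.symm c + v := by
      ext i; simp
    rw [this, coeff_mul_monomial, mul_one]
  have hinj : Function.Injective fun c : Fin k → ℕ => c + ⇑v := add_left_injective _
  calc boxCoeffSum s P = ∑ c ∈ (Fintype.piFinset (fun _ : Fin k => Finset.range (s + 1))).map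
        ⟨_, hinj⟩, coeff (Finsupp.equivFunOnFinite.symm c) (P * monomial v 1) := by
        rw [Finset.sum_map]
        exact Finset.sum_congr rfl fun c _ => e c
    _ ≤ _ := by
        refine Finset.sum_le_sum_of_subset_of_nonneg ?_
          fun _ _ _ => hP.mul (CoeffNonneg.monomial v) _
        intro c hc
        obtain ⟨b, hb, rfl⟩ := Finset.mem_map.mp hc
        simp only [Fintype.mem_piFinset, Finset.mem_range, Function.Embedding.coeFn_mk,
          Pi.add_apply] at hb ⊢
        intro i
        have := hb i
        have := hv i
        omega

theorem completeHomogLE_sub_nonneg (k : ℕ) {s t : ℕ} (h : s ≤ t) :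
    CoeffNonneg (completeHomogLE k t - completeHomogLE k s) := by
  rw [completeHomogLE, completeHomogLE,
    ← Finset.sum_sdiff (Finset.range_mono (Nat.add_le_add_right h 1)), add_sub_cancel_right]
  exact CoeffNonneg.sum fun a _ => coeffNonneg_completeHomog k a

theorem pow_sub_pow_nonneg {k : ℕ} {P Q : MvPolynomial (Fin k) ℤ} (hP : CoeffNonneg P)
    (h : CoeffNonneg (Q - P)) (n : ℕ) : CoeffNonneg (Q ^ n - P ^ n) := by
  simpa using CoeffNonneg.prod_sub_prod (s := Finset.range n) (f := fun _ => P) (g := fun _ => Q)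
    (fun _ _ => hP) (fun _ _ => h)

theorem coeffNonneg_pow {k : ℕ} {P : MvPolynomial (Fin k) ℤ} (hP : CoeffNonneg P) (n : ℕ) :
    CoeffNonneg (P ^ n) := by
  simpa using CoeffNonneg.prod (s := Finset.range n) (f := fun _ => P) (fun _ _ => hP)

/-- The unnormalised smoothing polynomial `∏_j (∑_{a ≤ M} X_j^a)^N`. -/
def smoothingPoly (k N M : ℕ) : MvPolynomial (Fin k) ℤ :=
  ∏ p : Fin k × Fin N, ∑ a ∈ Finset.range (M + 1), monomial (Finsupp.single p.1 a) 1

/-- The homogeneous smoothing polynomial `∏_{j,l} (∑_{a ≤ M} X_j^a X_l^(M-a))^N`. -/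
def homogSmoothingPoly (k N M : ℕ) : MvPolynomial (Fin k) ℤ :=
  ∏ p : Fin k × Fin k × Fin N, ∑ a ∈ Finset.range (M + 1),
    monomial (Finsupp.single p.1 a + Finsupp.single p.2.1 (M - a)) 1

theorem isSymmetric_smoothingPoly (k N M : ℕ) : (smoothingPoly k N M).IsSymmetric := by
  intro σ
  rw [smoothingPoly, map_prod]
  refine Fintype.prod_equiv (σ.prodCongr (Equiv.refl _)) _ _ fun p => ?_
  simp [map_sum, rename_monomial]

theorem isSymmetric_homogSmoothingPoly (k N M : ℕ) : (homogSmoothingPoly k N M).IsSymmetric := by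
  intro σ
  rw [homogSmoothingPoly, map_prod]
  refine Fintype.prod_equiv (σ.prodCongr (σ.prodCongr (Equiv.refl _))) _ _ fun p => ?_
  simp [map_sum, rename_monomial, Finsupp.mapDomain_add, -Finsupp.single_tsub]

theorem prod_monomial {k : ℕ} {ι : Type*} (s : Finset ι) (v : ι → Fin k →₀ ℕ) :
    ∏ i ∈ s, monomial (v i) (1 : ℤ) = monomial (∑ i ∈ s, v i) 1 := by
  classical
  induction s using Finset.induction_on with
  | empty => simp
  | insert a s ha ih => rw [Finset.prod_insert ha, Finset.sum_insert ha, ih, monomial_mul, one_mul]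

/-- The smoothing polynomial is a sum of `(M + 1) ^ (k N)` monomials with all exponents at most `N
M`. Multiplication by one of them keeps the box of side `t - N M` inside the box of side `t`. -/
theorem boxCoeffSum_smoothing_ge (k N M t : ℕ) (h : N * M ≤ t) :
    ((M : ℤ) + 1) ^ (k * N) * boxCoeffSum (t - N * M) (completeHomogLE k (t - N * M) ^ k) ≤
      boxCoeffSum t (completeHomogLE k t ^ k * smoothingPoly k N M) := by
  classical
  rw [smoothingPoly, Finset.prod_univ_sum, Finset.mul_sum, boxCoeffSum.eq_def t]
  simp only [coeff_sum]
  rw [Finset.sum_comm]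
  have hcard : ((M : ℤ) + 1) ^ (k * N) =
      (Fintype.piFinset fun _ : Fin k × Fin N => Finset.range (M + 1)).card := by
    simp
  rw [hcard, ← nsmul_eq_mul]
  refine Finset.card_nsmul_le_sum _ _ _ fun α hα => ?_
  have hα' : ∀ p, α p ≤ M := fun p =>
    Nat.lt_succ_iff.mp (Finset.mem_range.mp (Fintype.mem_piFinset.mp hα p))
  rw [prod_monomial]
  refine le_trans ?_ (boxCoeffSum_le_mul_monomial (s := t - N * M) (t := t)
    (coeffNonneg_pow (coeffNonneg_completeHomogLE k t) k) ?_)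
  · rw [← sub_nonneg, ← boxCoeffSum_sub]
    exact boxCoeffSum_nonneg _ (pow_sub_pow_nonneg (coeffNonneg_completeHomogLE k _)
      (completeHomogLE_sub_nonneg k (Nat.sub_le _ _)) k)
  · intro i
    have : (∑ p : Fin k × Fin N, Finsupp.single p.1 (α p)) i ≤ N * M := by
      rw [Finsupp.finsetSum_apply, Fintype.sum_prod_type,
        Finset.sum_eq_single i (by intro b _ hb; simp [hb]) (by simp)]
      simp only [Finsupp.single_eq_same]
      calc ∑ ν, α (i, ν) ≤ ∑ ν : Fin N, M := Finset.sum_le_sum fun ν _ => hα' _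
        _ = N * M := by simp
    omega

/-- Every coefficient of `h_t` in degree `t` is `1`, and the monomials of `h_s · x ^ w` are distinct
and of degree `t`. -/
theorem completeHomog_sub_mul_monomial_nonneg {k s t : ℕ} (w : Fin k →₀ ℕ)
    (hw : s + ∑ i, w i = t) :
    CoeffNonneg (completeHomog k t - completeHomog k s * monomial w 1) := by
  intro a
  rw [coeff_sub, coeff_mul_monomial', coeff_completeHomog, coeff_completeHomog]
  by_cases hwa : w ≤ a
  · rw [if_pos hwa]
    have : (∑ i, (a - w) i) + ∑ i, w i = ∑ i, a i := by
      rw [← Finset.sum_add_distrib]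
      exact Finset.sum_congr rfl fun i _ => Nat.sub_add_cancel (hwa i)
    by_cases h : ∑ i, (a - w) i = s
    · rw [if_pos h, if_pos (by omega)]
      simp
    · rw [if_neg h]
      split_ifs <;> simp
  · rw [if_neg hwa]
    split_ifs <;> simp

/-- The degree of `h` is lowered by `k N M` because the smoothing polynomial has degree `k · k N M`,
so that the total degree is again `k t`. For each of its monomials, a magic square of line sum `t -
2 k N M` is completed to a matrix counted on the right, by adding a fixed vector to each row. -/
theorem coeff_homogSmoothing_ge (k N M t : ℕ) (h : 2 * (k * (N * M)) ≤ t) :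
    ((M : ℤ) + 1) ^ (k * (k * N)) *
      coeff (Finsupp.equivFunOnFinite.symm fun _ => t - 2 * (k * (N * M)))
        (completeHomog k (t - 2 * (k * (N * M))) ^ k) ≤
      coeff (Finsupp.equivFunOnFinite.symm fun _ => t)
        (completeHomog k (t - k * (N * M)) ^ k * homogSmoothingPoly k N M) := by
  classical
  rw [homogSmoothingPoly, Finset.prod_univ_sum, Finset.mul_sum, coeff_sum]
  have hcard : ((M : ℤ) + 1) ^ (k * (k * N)) =
      (Fintype.piFinset fun _ : Fin k × Fin k × Fin N => Finset.range (M + 1)).card := by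
    simp
  rw [hcard, ← nsmul_eq_mul]
  refine Finset.card_nsmul_le_sum _ _ _ fun α hα => ?_
  have hα' : ∀ p, α p ≤ M := fun p =>
    Nat.lt_succ_iff.mp (Finset.mem_range.mp (Fintype.mem_piFinset.mp hα p))
  rw [prod_monomial]
  set s := t - 2 * (k * (N * M)) with hs
  set v := ∑ p : Fin k × Fin k × Fin N,
    (Finsupp.single p.1 (α p) + Finsupp.single p.2.1 (M - α p)) with hv
  -- The complement of the chosen monomial: against `X_j ^ a X_l ^ (M - a)` row `j` receives `X_j ^
  -- (M - a) X_l ^ a`. The product `X_j ^ M X_l ^ M` no longer depends on `a`, and over all factors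
  -- every variable collects exponent `2 k N M`.
  let w : Fin k → Fin k →₀ ℕ := fun j => ∑ q : Fin k × Fin N,
    (Finsupp.single j (M - α (j, q)) + Finsupp.single q.1 (α (j, q)))
  have hw : ∀ j, s + ∑ i, w j i = t - k * (N * M) := by
    intro j
    have : ∑ i, w j i = k * (N * M) := by
      simp only [w, Finsupp.finsetSum_apply, Finsupp.add_apply]
      rw [Finset.sum_comm]
      have : ∀ q : Fin k × Fin N, ∑ i, (Finsupp.single j (M - α (j, q)) i +
          Finsupp.single q.1 (α (j, q)) i) = M := by
        intro q
        rw [Finset.sum_add_distrib]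
        simp [Finsupp.single_apply, Nat.sub_add_cancel (hα' (j, q)), -Finsupp.single_tsub]
      rw [Finset.sum_congr rfl fun q _ => this q]
      simp [mul_assoc]
    omega
  have hsum : ∑ j, w j + v = Finsupp.equivFunOnFinite.symm fun _ => 2 * (k * (N * M)) := by
    have e1 : ∑ j, w j + v = ∑ p : Fin k × Fin k × Fin N,
        (Finsupp.single p.1 M + Finsupp.single p.2.1 M) := by
      rw [hv, Fintype.sum_prod_type, Fintype.sum_prod_type, ← Finset.sum_add_distrib]
      refine Finset.sum_congr rfl fun j _ => ?_
      rw [← Finset.sum_add_distrib]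
      refine Finset.sum_congr rfl fun q _ => ?_
      rw [add_add_add_comm, ← Finsupp.single_add, add_comm (Finsupp.single q.1 _),
        ← Finsupp.single_add, Nat.sub_add_cancel (hα' (j, q))]
    rw [e1]
    ext i
    simp only [Finsupp.finsetSum_apply, Finsupp.add_apply, Finset.sum_add_distrib,
      Fintype.sum_prod_type, Finsupp.single_apply]
    simp
    ring
  have key : CoeffNonneg ((completeHomog k (t - k * (N * M)) ^ k -
      completeHomog k s ^ k * monomial (∑ j, w j) 1) * monomial v 1) := by
    refine CoeffNonneg.mul ?_ (CoeffNonneg.monomial v)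
    have := CoeffNonneg.prod_sub_prod (s := Finset.univ)
      (f := fun j : Fin k => completeHomog k s * monomial (w j) 1)
      (g := fun _ => completeHomog k (t - k * (N * M)))
      (fun j _ => (coeffNonneg_completeHomog k s).mul (CoeffNonneg.monomial _))
      (fun j _ => completeHomog_sub_mul_monomial_nonneg (w j) (hw j))
    rwa [Finset.prod_mul_distrib, prod_monomial, Finset.prod_const, Finset.prod_const,
      Finset.card_univ, Fintype.card_fin] at this
  have := key (Finsupp.equivFunOnFinite.symm fun _ => t)
  rw [sub_mul, coeff_sub, mul_assoc, monomial_mul, one_mul, hsum, sub_nonneg] at this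
  refine le_trans (le_of_eq ?_) this
  have e : (Finsupp.equivFunOnFinite.symm fun _ => t : Fin k →₀ ℕ) =
      (Finsupp.equivFunOnFinite.symm fun _ => s) +
        Finsupp.equivFunOnFinite.symm fun _ => 2 * (k * (N * M)) := by
    ext i
    simp only [Finsupp.equivFunOnFinite_symm_apply_apply, Finsupp.add_apply]
    omega
  rw [e, coeff_mul_monomial, mul_one]


/-! ### Fourier analysis on the torus -/

open MvPolynomial

/-- The additive character `u ↦ exp (2πiu)`. -/
def phase (u : ℝ) : ℂ := Complex.exp ((2 * Real.pi * u : ℝ) * Complex.I)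

theorem phase_add (u v : ℝ) : phase (u + v) = phase u * phase v := by
  rw [phase, phase, phase, ← Complex.exp_add]
  congr 1
  push_cast
  ring

@[simp] theorem phase_zero : phase 0 = 1 := by simp [phase]

@[simp] theorem norm_phase (u : ℝ) : ‖phase u‖ = 1 := Complex.norm_exp_ofReal_mul_I _

theorem conj_phase (u : ℝ) : (starRingEnd ℂ) (phase u) = phase (-u) := by
  rw [phase, phase, ← Complex.exp_conj, map_mul, Complex.conj_ofReal, Complex.conj_I]
  congr 1
  push_cast
  ring

theorem phase_pow (u : ℝ) (n : ℕ) : phase u ^ n = phase (n * u) := by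
  rw [phase, phase, ← Complex.exp_nat_mul]
  congr 1
  push_cast
  ring

theorem phase_sum {ι : Type*} (s : Finset ι) (u : ι → ℝ) :
    phase (∑ i ∈ s, u i) = ∏ i ∈ s, phase (u i) := by
  simp only [phase]
  rw [← Complex.exp_sum, ← Finset.sum_mul, Finset.mul_sum, Complex.ofReal_sum]

@[fun_prop] theorem continuous_phase : Continuous phase := by
  unfold phase
  fun_prop

/-- The fundamental domain `(-1/2, 1/2]^d`. -/
def unitBox (d : ℕ) : Set (Fin d → ℝ) := Set.univ.pi fun _ => Set.Ioc (-(1 / 2)) (1 / 2)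

theorem measurableSet_unitBox (d : ℕ) : MeasurableSet (unitBox d) :=
  MeasurableSet.univ_pi fun _ => measurableSet_Ioc

theorem integral_phase_int (n : ℤ) :
    ∫ u in Set.Ioc (-(1 / 2 : ℝ)) (1 / 2), phase (n * u) = if n = 0 then 1 else 0 := by
  rw [← intervalIntegral.integral_of_le (by norm_num)]
  split_ifs with h
  · simp [h]
    norm_num
  · have hc : (2 * Real.pi * n * Complex.I : ℂ) ≠ 0 := by
      simp [Real.pi_ne_zero, h]
    have e : ∀ u : ℝ, phase (n * u) = Complex.exp ((2 * Real.pi * n * Complex.I : ℂ) * u) := by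
      intro u
      rw [phase]
      congr 1
      push_cast
      ring
    simp_rw [e]
    rw [integral_exp_mul_complex hc, div_eq_zero_iff, sub_eq_zero]
    left
    rw [Complex.exp_eq_exp_iff_exists_int]
    exact ⟨n, by push_cast; ring⟩

theorem integral_unitBox_phase {d : ℕ} (n : Fin d → ℤ) :
    ∫ θ in unitBox d, phase (∑ i, n i * θ i) = if n = 0 then 1 else 0 := by
  simp_rw [phase_sum]
  rw [unitBox, volume_pi, Measure.restrict_pi_pi,
    integral_fintype_prod_eq_prod (fun i u => phase (n i * u))]
  simp_rw [integral_phase_int]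
  split_ifs with h
  · simp [h]
  · obtain ⟨i, hi⟩ := Function.ne_iff.mp h
    exact Finset.prod_eq_zero (Finset.mem_univ i) (if_neg hi)

theorem integrableOn_unitBox {d : ℕ} {E : Type*} [NormedAddCommGroup E]
    {f : (Fin d → ℝ) → E} (hf : Continuous f) : IntegrableOn f (unitBox d) := by
  have : unitBox d ⊆ Set.Icc (fun _ => -(1 / 2)) (fun _ => 1 / 2) := fun x hx =>
    ⟨fun i => (hx i trivial).1.le, fun i => (hx i trivial).2⟩
  exact (hf.continuousOn.integrableOn_compact isCompact_Icc).mono_set this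

/-- Evaluation of an integral polynomial at the unimodular point `(e^{2πiφ_j})_j`. -/
def evalPhase {k : ℕ} (P : MvPolynomial (Fin k) ℤ) (φ : Fin k → ℝ) : ℂ :=
  aeval (fun j => phase (φ j)) P

theorem evalPhase_eq_sum {k : ℕ} (P : MvPolynomial (Fin k) ℤ) (φ : Fin k → ℝ) :
    evalPhase P φ = ∑ a ∈ P.support, ((coeff a P : ℤ) : ℂ) * phase (∑ j, a j * φ j) := by
  rw [evalPhase, aeval_def, eval₂_eq']
  refine Finset.sum_congr rfl fun a _ => ?_
  simp only [phase_sum, phase_pow]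
  rfl

theorem evalPhase_mul {k : ℕ} (P Q : MvPolynomial (Fin k) ℤ) (φ : Fin k → ℝ) :
    evalPhase (P * Q) φ = evalPhase P φ * evalPhase Q φ := map_mul _ _ _

theorem evalPhase_pow {k : ℕ} (P : MvPolynomial (Fin k) ℤ) (n : ℕ) (φ : Fin k → ℝ) :
    evalPhase (P ^ n) φ = evalPhase P φ ^ n := map_pow _ _ _

theorem evalPhase_monomial {k : ℕ} (a : Fin k →₀ ℕ) (φ : Fin k → ℝ) :
    evalPhase (monomial a 1) φ = phase (∑ j, a j * φ j) := by
  simp [evalPhase, aeval_monomial, phase_sum, phase_pow, Finsupp.prod_fintype]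

theorem evalPhase_sum {k : ℕ} {ι : Type*} (s : Finset ι) (f : ι → MvPolynomial (Fin k) ℤ)
    (φ : Fin k → ℝ) : evalPhase (∑ i ∈ s, f i) φ = ∑ i ∈ s, evalPhase (f i) φ := map_sum _ _ _

theorem evalPhase_prod {k : ℕ} {ι : Type*} (s : Finset ι) (f : ι → MvPolynomial (Fin k) ℤ)
    (φ : Fin k → ℝ) : evalPhase (∏ i ∈ s, f i) φ = ∏ i ∈ s, evalPhase (f i) φ := map_prod _ _ _

theorem continuous_evalPhase {k : ℕ} (P : MvPolynomial (Fin k) ℤ) :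
    Continuous (evalPhase P) := by
  rw [funext (evalPhase_eq_sum P)]
  fun_prop

/-- Parseval's identity on the torus. -/
theorem integral_evalPhase_mul_conj {d k : ℕ} (φ : (Fin d → ℝ) → Fin k → ℝ)
    (π : (Fin k →₀ ℕ) → Fin d → ℤ)
    (hφ : ∀ a θ, ∑ j, (a j : ℝ) * φ θ j = ∑ i, (π a i : ℝ) * θ i)
    (P Q : MvPolynomial (Fin k) ℤ)
    (hinj : ∀ a ∈ P.support, ∀ b ∈ Q.support, π a = π b → a = b) :
    ∫ θ in unitBox d, evalPhase P (φ θ) * (starRingEnd ℂ) (evalPhase Q (φ θ)) =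
      (coeffPairing P Q : ℤ) := by
  classical
  -- Expand both factors into characters. Injectivity of `π` across the supports means that only the
  -- diagonal terms have frequency zero.
  have e : ∀ θ, evalPhase P (φ θ) * (starRingEnd ℂ) (evalPhase Q (φ θ)) =
      ∑ a ∈ P.support, ∑ b ∈ Q.support, ((coeff a P : ℤ) : ℂ) * ((coeff b Q : ℤ) : ℂ) *
        phase (∑ i, ((π a - π b) i : ℤ) * θ i) := by
    intro θ
    rw [evalPhase_eq_sum, evalPhase_eq_sum, map_sum, Finset.sum_mul_sum]
    refine Finset.sum_congr rfl fun a _ => Finset.sum_congr rfl fun b _ => ?_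
    rw [map_mul, conj_phase, hφ, hφ, mul_mul_mul_comm, ← phase_add]
    congr 1
    · simp
    · congr 1
      rw [← sub_eq_add_neg, ← Finset.sum_sub_distrib]
      refine Finset.sum_congr rfl fun i _ => ?_
      rw [Pi.sub_apply]
      push_cast
      ring
  simp_rw [e]
  have hcont : ∀ n : Fin d → ℤ, Continuous fun θ : Fin d → ℝ => phase (∑ i, (n i : ℝ) * θ i) :=
    fun n => by fun_prop
  rw [integral_finsetSum _ fun a _ => integrableOn_unitBox
    (continuous_finsetSum _ fun b _ => (hcont _).const_mul _)]
  simp only [coeffPairing, LinearMap.coe_mk, AddHom.coe_mk]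
  push_cast
  refine Finset.sum_congr rfl fun a ha => ?_
  rw [integral_finsetSum _ fun b _ => integrableOn_unitBox ((hcont _).const_mul _)]
  have : ∀ b ∈ Q.support, ∫ θ in unitBox d, ((coeff a P : ℤ) : ℂ) * ((coeff b Q : ℤ) : ℂ) *
        phase (∑ i, ((π a - π b) i : ℤ) * θ i) =
      if a = b then ((coeff a P : ℤ) : ℂ) * ((coeff b Q : ℤ) : ℂ) else 0 := by
    intro b hb
    rw [integral_const_mul, integral_unitBox_phase]
    by_cases hab : a = b
    · simp [hab]
    · have : π a - π b ≠ 0 := fun h => hab (hinj a ha b hb (sub_eq_zero.mp h))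
      simp [hab, this]
  rw [Finset.sum_congr rfl this, Finset.sum_ite_eq]
  split_ifs with h
  · rfl
  · simp [notMem_support_iff.mp h]

/-- The normalised Dirichlet kernel modulus `|∑_{a ≤ M} e^{2πiau}| / (M + 1)`. -/
def avgKernel (M : ℕ) (u : ℝ) : ℝ := ‖∑ a ∈ Finset.range (M + 1), phase (a * u)‖ / (M + 1)

theorem avgKernel_nonneg (M : ℕ) (u : ℝ) : 0 ≤ avgKernel M u := by unfold avgKernel; positivity

theorem avgKernel_le_one (M : ℕ) (u : ℝ) : avgKernel M u ≤ 1 := by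
  rw [avgKernel, div_le_one (by positivity)]
  refine (norm_sum_le _ _).trans ?_
  simp

@[fun_prop] theorem continuous_avgKernel (M : ℕ) : Continuous (avgKernel M) := by
  unfold avgKernel
  fun_prop

theorem norm_evalPhase_smoothingPoly (k N M : ℕ) (θ : Fin k → ℝ) :
    ‖evalPhase (smoothingPoly k N M) θ‖ =
      ((M : ℝ) + 1) ^ (k * N) * ∏ j, avgKernel M (θ j) ^ N := by
  have : ∀ p : Fin k × Fin N, ‖evalPhase (∑ a ∈ Finset.range (M + 1),
      monomial (Finsupp.single p.1 a) 1) θ‖ = ((M : ℝ) + 1) * avgKernel M (θ p.1) := by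
    intro p
    rw [avgKernel, mul_div_cancel₀ _ (by positivity), evalPhase_sum]
    congr 1
    refine Finset.sum_congr rfl fun a _ => ?_
    rw [evalPhase_monomial]
    congr 1
    simp [Finsupp.single_apply]
  rw [smoothingPoly, evalPhase_prod, norm_prod, Finset.prod_congr rfl fun p _ => this p,
    Finset.prod_mul_distrib, Fintype.prod_prod_type (fun p => avgKernel M (θ (Prod.fst p)))]
  simp

theorem norm_evalPhase_homogFactor_le {k : ℕ} (M : ℕ) (φ : Fin k → ℝ) (j l : Fin k) :
    ‖evalPhase (∑ a ∈ Finset.range (M + 1),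
      monomial (Finsupp.single j a + Finsupp.single l (M - a)) 1) φ‖ ≤ (M : ℝ) + 1 := by
  rw [evalPhase_sum]
  refine (norm_sum_le _ _).trans ?_
  simp only [evalPhase_monomial, norm_phase, Finset.sum_const, Finset.card_range]
  simp

/-- Only the factors for pairs `(0, i + 1)` are used: with the first phase frozen at `0` they are
Dirichlet kernels in `θ i`. All other factors are bounded by `M + 1`. -/
theorem norm_evalPhase_homogSmoothingPoly_le (d N M : ℕ) (θ : Fin d → ℝ) :
    ‖evalPhase (homogSmoothingPoly (d + 1) N M) (Fin.cons 0 θ)‖ ≤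
      ((M : ℝ) + 1) ^ ((d + 1) * ((d + 1) * N)) * ∏ i, avgKernel M (θ i) ^ N := by
  have h0 : ∀ i : Fin d, ‖evalPhase (∑ a ∈ Finset.range (M + 1),
      monomial (Finsupp.single (0 : Fin (d + 1)) a + Finsupp.single i.succ (M - a)) 1)
        (Fin.cons 0 θ)‖ = ((M : ℝ) + 1) * avgKernel M (θ i) := by
    intro i
    rw [avgKernel, mul_div_cancel₀ _ (by positivity), evalPhase_sum, ← Finset.sum_range_reflect]
    congr 1
    refine Finset.sum_congr rfl fun a ha => ?_
    have ha' := Finset.mem_range.mp ha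
    have : M - (M + 1 - 1 - a) = a := by omega
    rw [evalPhase_monomial, this]
    congr 1
    simp [Finsupp.single_apply, Fin.sum_univ_succ, (Fin.succ_ne_zero _).symm]
  have h1 : ∀ (j l : Fin (d + 1)) , ‖evalPhase (∑ a ∈ Finset.range (M + 1),
      monomial (Finsupp.single j a + Finsupp.single l (M - a)) 1) (Fin.cons 0 θ)‖ ≤
      ((M : ℝ) + 1) * (Fin.cons (Fin.cons 1 fun i => avgKernel M (θ i)) (fun _ _ => 1) :
        Fin (d + 1) → Fin (d + 1) → ℝ) j l := by
    intro j l
    refine Fin.cases ?_ (fun j => ?_) j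
    · refine Fin.cases ?_ (fun l => ?_) l
      · simpa using norm_evalPhase_homogFactor_le M (Fin.cons 0 θ) 0 0
      · simpa using (h0 l).le
    · simpa using norm_evalPhase_homogFactor_le M (Fin.cons 0 θ) j.succ l
  rw [homogSmoothingPoly, evalPhase_prod, norm_prod]
  refine (Finset.prod_le_prod (fun _ _ => norm_nonneg _) fun p _ => h1 p.1 p.2.1).trans
    (le_of_eq ?_)
  rw [Finset.prod_mul_distrib]
  congr 1
  · simp
  · simp [Fintype.prod_prod_type, Fin.prod_univ_succ]


/-! ### Lattice counts as moments on the torus -/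

open MvPolynomial

/-- The exponential sum `∑_{a ∈ ℕ^d, |a| ≤ t} e^{2πi a·θ}`. -/
def simplexExpSum (d t : ℕ) (θ : Fin d → ℝ) : ℂ := evalPhase (completeHomogLE d t) θ

theorem continuous_simplexExpSum (d t : ℕ) : Continuous (simplexExpSum d t) :=
  continuous_evalPhase _

theorem evalPhase_completeHomog (k n : ℕ) (φ : Fin k → ℝ) :
    evalPhase (completeHomog k n) φ =
      PowerSeries.coeff n (∏ l : Fin k, PowerSeries.mk fun m => phase (φ l) ^ m) := by
  rw [PowerSeries.coeff_prod, completeHomog, evalPhase_sum]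
  refine Finset.sum_congr rfl fun a _ => ?_
  simp [evalPhase_monomial, phase_sum, phase_pow]

/-- Setting one variable to `1` turns its geometric series into `∑ Y ^ n`, and multiplication by
this series forms partial sums of coefficients. -/
theorem evalPhase_completeHomog_cons (d t : ℕ) (θ : Fin d → ℝ) :
    evalPhase (completeHomog (d + 1) t) (Fin.cons 0 θ) = simplexExpSum d t θ := by
  rw [evalPhase_completeHomog, Fin.prod_univ_succ, mul_comm, PowerSeries.coeff_mul,
    Finset.Nat.sum_antidiagonal_eq_sum_range_succ_mk, simplexExpSum, completeHomogLE, evalPhase_sum]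
  refine Finset.sum_congr rfl fun n _ => ?_
  simp [evalPhase_completeHomog]

theorem integral_norm_sq_of_parseval {d : ℕ} {f : (Fin d → ℝ) → ℂ} {c : ℤ}
    (h : ∫ θ in unitBox d, f θ * (starRingEnd ℂ) (f θ) = (c : ℂ)) :
    ∫ θ in unitBox d, ‖f θ‖ ^ 2 = c := by
  simp_rw [Complex.mul_conj'] at h
  have h2 := integral_ofReal (𝕜 := ℂ) (f := fun θ => ‖f θ‖ ^ 2) (μ := volume.restrict (unitBox d))
  simp only [Complex.coe_algebraMap, RCLike.ofReal_pow] at h2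
  have h3 := h2.symm.trans h
  exact Complex.ofReal_injective (by simpa using h3)

/-- Pointwise, `2 (|A w|) (|B w| κ) ≤ |A w|² + (|B w| κ)²`. The whole weight `κ` goes to `B`: the
`A` term remains a plain moment, which is a known count, and the `B` term acquires the decay `κ²`.
-/
theorem norm_integral_smoothed_le {d : ℕ} {A B G w : (Fin d → ℝ) → ℂ} {κ : (Fin d → ℝ) → ℝ}
    (hA : Continuous A) (hB : Continuous B) (hw : Continuous w)
    (hκ : Continuous κ) {c : ℝ} (hc : 0 ≤ c) (hGκ : ∀ θ, ‖G θ‖ ≤ c * κ θ) :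
    ‖∫ θ in unitBox d, (A θ * G θ * w θ) * (starRingEnd ℂ) (B θ * w θ)‖ ≤
      c * ((∫ θ in unitBox d, ‖A θ‖ ^ 2 * ‖w θ‖ ^ 2) / 2 +
        (∫ θ in unitBox d, ‖B θ‖ ^ 2 * ‖w θ‖ ^ 2 * κ θ ^ 2) / 2) := by
  have hi : IntegrableOn (fun θ => c * (‖A θ‖ ^ 2 * ‖w θ‖ ^ 2 / 2 +
      ‖B θ‖ ^ 2 * ‖w θ‖ ^ 2 * κ θ ^ 2 / 2)) (unitBox d) :=
    integrableOn_unitBox (by fun_prop)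
  refine (norm_integral_le_of_norm_le hi (ae_of_all _ fun θ => ?_)).trans (le_of_eq ?_)
  · rw [norm_mul, norm_mul, norm_mul, RCLike.norm_conj, norm_mul]
    calc ‖A θ‖ * ‖G θ‖ * ‖w θ‖ * (‖B θ‖ * ‖w θ‖)
        ≤ ‖A θ‖ * (c * κ θ) * ‖w θ‖ * (‖B θ‖ * ‖w θ‖) := by gcongr; exact hGκ θ
      _ = c * ((‖A θ‖ * ‖w θ‖) * (‖B θ‖ * ‖w θ‖ * κ θ)) := by ring
      _ ≤ _ := by
        refine mul_le_mul_of_nonneg_left ?_ hc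
        nlinarith [sq_nonneg (‖A θ‖ * ‖w θ‖ - ‖B θ‖ * ‖w θ‖ * κ θ)]
  · rw [integral_const_mul, integral_add, integral_div, integral_div]
    · exact integrableOn_unitBox (by fun_prop)
    · exact integrableOn_unitBox (by fun_prop)

section SubBirkhoff

variable (k : ℕ)

theorem parseval_full (P Q : MvPolynomial (Fin k) ℤ) :
    ∫ θ in unitBox k, evalPhase P θ * (starRingEnd ℂ) (evalPhase Q θ) =
      (coeffPairing P Q : ℤ) :=
  integral_evalPhase_mul_conj (fun θ => θ) (fun a i => a i) (fun a θ => by simp) P Q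
    fun a _ b _ h => by
      ext i
      exact_mod_cast congrFun h i

theorem integral_simplexExpSum_subBirkhoff (t : ℕ) :
    ∫ θ in unitBox k, ‖simplexExpSum k t θ‖ ^ (2 * k) * ‖evalPhase (vandermondePoly k) θ‖ ^ 2 =
      k.factorial * (boxCoeffSum t (completeHomogLE k t ^ k) : ℤ) := by
  have hs : (completeHomogLE k t ^ k).IsSymmetric := (isSymmetric_completeHomogLE k t).pow k
  have h := integral_norm_sq_of_parseval
    (parseval_full k (completeHomogLE k t ^ k * vandermondePoly k) _)
  rw [coeffPairing_completeHomogLE hs] at h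
  push_cast at h
  rw [← h]
  simp only [evalPhase_mul, evalPhase_pow, norm_mul, norm_pow, mul_pow, ← pow_mul, mul_comm k 2]
  rfl

/-- The pairing of `H_t ^ k G Δ` with `H_t ^ k Δ`, for `G` the smoothing polynomial, is bounded
below by counting and above by `norm_integral_smoothed_le`. The common factor `(M + 1) ^ (k N)`
cancels. -/
theorem subBirkhoff_smoothed_le (N M t : ℕ) (h : N * M ≤ t) :
    (k.factorial : ℝ) * (boxCoeffSum (t - N * M) (completeHomogLE k (t - N * M) ^ k) : ℤ) ≤
      k.factorial * (boxCoeffSum t (completeHomogLE k t ^ k) : ℤ) / 2 +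
      (∫ θ in unitBox k, ‖simplexExpSum k t θ‖ ^ (2 * k) *
        ‖evalPhase (vandermondePoly k) θ‖ ^ 2 * ∏ j, avgKernel M (θ j) ^ (2 * N)) / 2 := by
  have hs : (completeHomogLE k t ^ k * smoothingPoly k N M).IsSymmetric :=
    IsSymmetric.mul ((isSymmetric_completeHomogLE k t).pow k) (isSymmetric_smoothingPoly k N M)
  have h1 := parseval_full k (completeHomogLE k t ^ k * smoothingPoly k N M * vandermondePoly k)
    (completeHomogLE k t ^ k * vandermondePoly k)
  rw [coeffPairing_completeHomogLE hs] at h1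
  have h2 := norm_integral_smoothed_le (d := k)
    (A := fun θ => simplexExpSum k t θ ^ k) (B := fun θ => simplexExpSum k t θ ^ k)
    (G := evalPhase (smoothingPoly k N M)) (w := evalPhase (vandermondePoly k))
    (κ := fun θ => ∏ j, avgKernel M (θ j) ^ N) (c := ((M : ℝ) + 1) ^ (k * N))
    ((continuous_simplexExpSum k t).pow k) ((continuous_simplexExpSum k t).pow k)
    (continuous_evalPhase _) (by fun_prop) (by positivity)
    (fun θ => (norm_evalPhase_smoothingPoly k N M θ).le)
  simp only [evalPhase_mul, evalPhase_pow] at h1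
  change ∫ θ in unitBox k, (simplexExpSum k t θ ^ k * _ * _) *
    (starRingEnd ℂ) (simplexExpSum k t θ ^ k * _) = _ at h1
  rw [h1] at h2
  simp only [norm_pow, ← pow_mul, mul_comm k 2] at h2
  rw [integral_simplexExpSum_subBirkhoff] at h2
  simp only [← Finset.prod_pow, ← pow_mul, mul_comm N 2] at h2
  have h3 := boxCoeffSum_smoothing_ge k N M t h
  have h4 : ((M : ℝ) + 1) ^ (k * N) * (boxCoeffSum (t - N * M)
      (completeHomogLE k (t - N * M) ^ k) : ℤ) ≤
      (boxCoeffSum t (completeHomogLE k t ^ k * smoothingPoly k N M) : ℤ) := by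
    exact_mod_cast h3
  have h5 : (k.factorial : ℝ) *
      (boxCoeffSum t (completeHomogLE k t ^ k * smoothingPoly k N M) : ℤ) ≤
      ‖((k.factorial * boxCoeffSum t (completeHomogLE k t ^ k * smoothingPoly k N M) : ℤ) : ℂ)‖ := by
    rw [Complex.norm_intCast]
    push_cast
    exact le_abs_self _
  refine le_of_mul_le_mul_left (le_trans ?_ (h5.trans h2))
    (by positivity : 0 < ((M : ℝ) + 1) ^ (k * N))
  rw [mul_left_comm]
  exact mul_le_mul_of_nonneg_left h4 (by positivity)

end SubBirkhoff

section Birkhoff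

/-- The number of magic squares: the coefficient of `h_t^k` at `(t, …, t)`. -/
def magicCoeff (k t : ℕ) : ℤ :=
  coeff (Finsupp.equivFunOnFinite.symm fun _ => t) (completeHomog k t ^ k)

/-- Adding `t - s` times the identity matrix injects magic squares of line sum `s` into those of
line sum `t`. -/
theorem magicCoeff_mono {k s t : ℕ} (h : s ≤ t) : magicCoeff k s ≤ magicCoeff k t := by
  have key := CoeffNonneg.prod_sub_prod (s := Finset.univ)
    (f := fun j : Fin k => completeHomog k s * monomial (Finsupp.single j (t - s)) 1)
    (g := fun _ => completeHomog k t)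
    (fun j _ => (coeffNonneg_completeHomog k s).mul (CoeffNonneg.monomial _))
    (fun j _ => completeHomog_sub_mul_monomial_nonneg _ (by
      simp [Finsupp.single_apply, -Finsupp.single_tsub]; omega))
  rw [Finset.prod_mul_distrib, prod_monomial, Finset.prod_const, Finset.prod_const,
      Finset.card_univ, Fintype.card_fin] at key
  have := key (Finsupp.equivFunOnFinite.symm fun _ => t)
  rw [coeff_sub, sub_nonneg] at this
  refine le_trans (le_of_eq ?_) this
  have e : (Finsupp.equivFunOnFinite.symm fun _ => t : Fin k →₀ ℕ) =
      (Finsupp.equivFunOnFinite.symm fun _ => s) + ∑ j : Fin k, Finsupp.single j (t - s) := by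
    ext i
    simp [Finsupp.single_apply, -Finsupp.single_tsub]
    omega
  rw [e, coeff_mul_monomial, mul_one, magicCoeff]

theorem isHomogeneous_completeHomog (k n : ℕ) : (completeHomog k n).IsHomogeneous n :=
  IsHomogeneous.sum _ _ _ fun a ha => isHomogeneous_monomial _ (by
    rw [Finset.mem_finsuppAntidiag] at ha
    rw [Finsupp.degree_eq_sum]
    exact ha.1)

theorem isHomogeneous_vandermondePoly (k : ℕ) :
    (vandermondePoly k).IsHomogeneous (∑ i : Fin k, (i : ℕ)) := by
  rw [vandermondePoly_eq_sum]
  refine IsHomogeneous.sum _ _ _ fun σ _ => isHomogeneous_monomial _ ?_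
  rw [Finsupp.degree_eq_sum]
  exact Equiv.sum_comp σ fun i => (i : ℕ)

theorem isHomogeneous_homogSmoothingPoly (k N M : ℕ) :
    (homogSmoothingPoly k N M).IsHomogeneous (k * (k * (N * M))) := by
  have : k * (k * (N * M)) = ∑ _p : Fin k × Fin k × Fin N, M := by simp; ring
  rw [this]
  refine IsHomogeneous.prod _ _ _ fun p _ => IsHomogeneous.sum _ _ _ fun a ha =>
    isHomogeneous_monomial _ ?_
  have := Finset.mem_range.mp ha
  rw [map_add, Finsupp.degree_single, Finsupp.degree_single]
  omega

variable (d : ℕ)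

/-- In a fixed degree the first exponent is determined by the others, so no frequencies collide when
the first phase is frozen at `0`. -/
theorem parseval_homogeneous {n : ℕ} {P Q : MvPolynomial (Fin (d + 1)) ℤ}
    (hP : P.IsHomogeneous n) (hQ : Q.IsHomogeneous n) :
    ∫ θ in unitBox d, evalPhase P (Fin.cons 0 θ) *
      (starRingEnd ℂ) (evalPhase Q (Fin.cons 0 θ)) = (coeffPairing P Q : ℤ) := by
  refine integral_evalPhase_mul_conj (fun θ => Fin.cons 0 θ) (fun a i => a i.succ)
    (fun a θ => by simp [Fin.sum_univ_succ]) P Q fun a ha b hb h => ?_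
  have h1 : ∀ i : Fin d, a i.succ = b i.succ := fun i => by exact_mod_cast congrFun h i
  have ea := hP.degree_eq_sum_deg_support ha
  have eb := hQ.degree_eq_sum_deg_support hb
  rw [← Finsupp.degree_apply, Finsupp.degree_eq_sum, Fin.sum_univ_succ] at ea eb
  simp only [h1] at ea
  ext i
  refine Fin.cases ?_ h1 i
  omega

theorem integral_simplexExpSum_birkhoff (t : ℕ) :
    ∫ θ in unitBox d, ‖simplexExpSum d t θ‖ ^ (2 * (d + 1)) *
      ‖evalPhase (vandermondePoly (d + 1)) (Fin.cons 0 θ)‖ ^ 2 =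
      (d + 1).factorial * (magicCoeff (d + 1) t : ℤ) := by
  have hs : (completeHomog (d + 1) t ^ (d + 1)).IsSymmetric := (isSymmetric_completeHomog (d + 1) t).pow (d + 1)
  have hh := ((isHomogeneous_completeHomog (d + 1) t).pow (d + 1)).mul
    (isHomogeneous_vandermondePoly (d + 1))
  have h := integral_norm_sq_of_parseval (parseval_homogeneous d hh hh)
  rw [coeffPairing_completeHomog_pow hs] at h
  push_cast at h
  rw [magicCoeff, ← h]
  simp only [evalPhase_mul, evalPhase_pow, norm_mul, norm_pow, mul_pow, ← pow_mul,
    mul_comm (d + 1) 2, evalPhase_completeHomog_cons]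

/-- The homogeneous analogue of `subBirkhoff_smoothed_le`. The two sides of the pairing use `h_s`
and `h_t` with different `s` and `t`, so the moment for `s` is afterwards replaced by the one for
`t` using `magicCoeff_mono`. -/
theorem birkhoff_smoothed_le (N M t : ℕ) (h : 2 * ((d + 1) * (N * M)) ≤ t) :
    ((d + 1).factorial : ℝ) * (magicCoeff (d + 1) (t - 2 * ((d + 1) * (N * M))) : ℤ) ≤
      (d + 1).factorial * (magicCoeff (d + 1) t : ℤ) / 2 +
      (∫ θ in unitBox d, ‖simplexExpSum d t θ‖ ^ (2 * (d + 1)) *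
        ‖evalPhase (vandermondePoly (d + 1)) (Fin.cons 0 θ)‖ ^ 2 *
          ∏ j, avgKernel M (θ j) ^ (2 * N)) / 2 := by
  set s := t - (d + 1) * (N * M) with hsdef
  have hs : (completeHomog (d + 1) s ^ (d + 1) * homogSmoothingPoly (d + 1) N M).IsSymmetric :=
    IsSymmetric.mul ((isSymmetric_completeHomog (d + 1) s).pow (d + 1)) (isSymmetric_homogSmoothingPoly _ N M)
  have hh1 := (((isHomogeneous_completeHomog (d + 1) s).pow (d + 1)).mul
    (isHomogeneous_homogSmoothingPoly (d + 1) N M)).mul (isHomogeneous_vandermondePoly (d + 1))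
  have hh2 := ((isHomogeneous_completeHomog (d + 1) t).pow (d + 1)).mul
    (isHomogeneous_vandermondePoly (d + 1))
  -- Parseval with a frozen phase needs equal degrees; this fixes `s`.
  have hdeg : s * (d + 1) + (d + 1) * ((d + 1) * (N * M)) = t * (d + 1) := by
    rw [mul_comm (d + 1), ← add_mul]
    congr 1
    omega
  rw [hdeg] at hh1
  have h1 := parseval_homogeneous d hh1 hh2
  rw [coeffPairing_completeHomog_pow hs] at h1
  have h2 := norm_integral_smoothed_le (d := d)
    (A := fun θ => simplexExpSum d s θ ^ (d + 1)) (B := fun θ => simplexExpSum d t θ ^ (d + 1))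
    (G := fun θ => evalPhase (homogSmoothingPoly (d + 1) N M) (Fin.cons 0 θ))
    (w := fun θ => evalPhase (vandermondePoly (d + 1)) (Fin.cons 0 θ))
    (κ := fun θ => ∏ j, avgKernel M (θ j) ^ N) (c := ((M : ℝ) + 1) ^ ((d + 1) * ((d + 1) * N)))
    ((continuous_simplexExpSum d s).pow _) ((continuous_simplexExpSum d t).pow _)
    ((continuous_evalPhase _).comp (continuous_const.finCons continuous_id))
    (by fun_prop) (by positivity)
    (fun θ => norm_evalPhase_homogSmoothingPoly_le d N M θ)
  simp only [evalPhase_mul, evalPhase_pow, evalPhase_completeHomog_cons] at h1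
  rw [h1] at h2
  simp only [norm_pow, ← pow_mul, mul_comm (d + 1) 2] at h2
  rw [integral_simplexExpSum_birkhoff] at h2
  simp only [← Finset.prod_pow, ← pow_mul, mul_comm N 2] at h2
  have h3 := coeff_homogSmoothing_ge (d + 1) N M t h
  rw [← hsdef] at h3
  set Z := coeff (Finsupp.equivFunOnFinite.symm fun _ => t)
        (completeHomog (d + 1) s ^ (d + 1) * homogSmoothingPoly (d + 1) N M) with hZ
  have h4 : ((M : ℝ) + 1) ^ ((d + 1) * ((d + 1) * N)) *
      (magicCoeff (d + 1) (t - 2 * ((d + 1) * (N * M))) : ℤ) ≤ (Z : ℤ) := by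
    exact_mod_cast h3
  have h5 : ((d + 1).factorial : ℝ) * (Z : ℤ) ≤
      ‖(((d + 1).factorial * Z : ℤ) : ℂ)‖ := by
    rw [Complex.norm_intCast]
    push_cast
    exact le_abs_self _
  have h6 : (magicCoeff (d + 1) s : ℝ) ≤ magicCoeff (d + 1) t := by
    exact_mod_cast magicCoeff_mono (Nat.sub_le _ _)
  refine le_of_mul_le_mul_left (le_trans ?_ ((h5.trans h2).trans ?_))
    (by positivity : 0 < ((M : ℝ) + 1) ^ ((d + 1) * ((d + 1) * N)))
  · rw [mul_left_comm]
    exact mul_le_mul_of_nonneg_left h4 (by positivity)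
  · gcongr

end Birkhoff


/-! ### Kernel bounds, Fatou's lemma and the rescaled integrands -/

open MvPolynomial in
theorem simplexExpSum_eq_sum (d t : ℕ) (θ : Fin d → ℝ) :
    simplexExpSum d t θ =
      ∑ a ∈ (Fintype.piFinset fun _ : Fin d => Finset.range (t + 1)) with ∑ j, a j ≤ t,
        phase (∑ j, (a j : ℝ) * θ j) := by
  classical
  simp only [simplexExpSum, completeHomogLE, completeHomog, evalPhase_sum, evalPhase_monomial]
  rw [Finset.sum_sigma']
  refine Finset.sum_bij' (fun x _ => ⇑x.2) (fun a _ => ⟨∑ j, a j, Finsupp.equivFunOnFinite.symm a⟩)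
    ?_ ?_ ?_ ?_ ?_
  · rintro ⟨n, a⟩ h
    simp only [Finset.mem_sigma, Finset.mem_range, Finset.mem_finsuppAntidiag] at h
    simp only [Finset.mem_filter, Fintype.mem_piFinset, Finset.mem_range]
    have h2 : ∑ j, a j ≤ t := by
      have : ∑ j, a j = n := h.2.1
      omega
    exact ⟨fun i => Nat.lt_succ_of_le
      ((Finset.single_le_sum (fun _ _ => Nat.zero_le _) (Finset.mem_univ i)).trans h2), h2⟩
  · intro a h
    simp only [Finset.mem_filter] at h
    simp only [Finset.mem_sigma, Finset.mem_range, Finset.mem_finsuppAntidiag]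
    exact ⟨Nat.lt_succ_of_le h.2, rfl, Finset.subset_univ _⟩
  · rintro ⟨n, a⟩ h
    simp only [Finset.mem_sigma, Finset.mem_finsuppAntidiag] at h
    obtain ⟨-, rfl, -⟩ := h
    congr 1
    ext i
    rfl
  · intro a _
    rfl
  · rintro ⟨n, a⟩ _
    rfl

theorem norm_simplexExpSum_le (d t : ℕ) (θ : Fin d → ℝ) :
    ‖simplexExpSum d t θ‖ ≤ ((t : ℝ) + 1) ^ d := by
  rw [simplexExpSum_eq_sum]
  refine (norm_sum_le _ _).trans ?_
  simp only [norm_phase, Finset.sum_const, nsmul_eq_mul, mul_one]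
  have := Finset.card_filter_le (Fintype.piFinset fun _ : Fin d => Finset.range (t + 1))
    (fun a => ∑ j, a j ≤ t)
  simp only [Fintype.card_piFinset, Finset.card_range, Finset.prod_const, Finset.card_univ,
    Fintype.card_fin] at this
  exact_mod_cast this

/-- The geometric sum telescopes to something of modulus at most `2`, and Jordan's inequality gives
`|e^{2πiu} - 1| = 2 |sin πu| ≥ 4 |u|` for `|u| ≤ 1/2`. -/
theorem abs_mul_avgKernel_le (M : ℕ) {u : ℝ} (hu : |u| ≤ 1 / 2) :
    2 * |u| * (M + 1) * avgKernel M u ≤ 1 := by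
  have h1 : ‖∑ a ∈ Finset.range (M + 1), phase (a * u)‖ = (M + 1) * avgKernel M u := by
    rw [avgKernel, mul_div_cancel₀ _ (by positivity)]
  have h2 : ‖phase u - 1‖ * ‖∑ a ∈ Finset.range (M + 1), phase (a * u)‖ ≤ 2 := by
    rw [← norm_mul]
    simp_rw [← phase_pow]
    rw [mul_geom_sum, phase_pow]
    refine (norm_sub_le _ _).trans ?_
    rw [norm_phase]
    norm_num
  have h3 : 4 * |u| ≤ ‖phase u - 1‖ := by
    have e : ‖phase u - 1‖ = 2 * |Real.sin (Real.pi * u)| := by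
      rw [phase, mul_comm, Complex.norm_exp_I_mul_ofReal_sub_one, norm_mul, Real.norm_eq_abs,
        Real.norm_eq_abs]
      norm_num
      congr 2
      ring
    have h4 : Real.sin (Real.pi * |u|) ≤ |Real.sin (Real.pi * u)| := by
      rcases abs_choice u with h | h
      · rw [h]
        exact le_abs_self _
      · rw [h, mul_neg, Real.sin_neg]
        exact neg_le_abs _
    have h5 := Real.mul_le_sin (x := Real.pi * |u|) (by positivity)
      (by nlinarith [Real.pi_pos])
    have h6 : 2 / Real.pi * (Real.pi * |u|) = 2 * |u| := by
      field_simp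
    rw [e]
    linarith
  rw [h1] at h2
  have h7 : 0 ≤ (M + 1) * avgKernel M u := mul_nonneg (by positivity) (avgKernel_nonneg _ _)
  nlinarith [mul_le_mul_of_nonneg_right h3 h7]

/-- Fatou's lemma for nonnegative real functions whose integrals converge. -/
theorem integrable_and_integral_le_of_tendsto {α : Type*} [MeasurableSpace α] {μ : Measure α}
    {G : ℕ → α → ℝ} {g : α → ℝ} {c : ℝ} (hm : ∀ n, Measurable (G n)) (h0 : ∀ n x, 0 ≤ G n x)
    (hi : ∀ n, Integrable (G n) μ) (hg : ∀ x, Tendsto (fun n => G n x) atTop (𝓝 (g x)))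
    (hc : Tendsto (fun n => ∫ x, G n x ∂μ) atTop (𝓝 c)) :
    Integrable g μ ∧ ∫ x, g x ∂μ ≤ c := by
  have hgm : Measurable g := measurable_of_tendsto_metrizable hm (tendsto_pi_nhds.mpr hg)
  have hg0 : ∀ x, 0 ≤ g x := fun x => ge_of_tendsto' (hg x) fun n => h0 n x
  have hc0 : 0 ≤ c := ge_of_tendsto' hc fun n => integral_nonneg (h0 n)
  have key : ∫⁻ x, ENNReal.ofReal (g x) ∂μ ≤ ENNReal.ofReal c := by
    have h1 := lintegral_liminf_le (μ := μ) (u := atTop)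
      (fun n => (hm n).ennreal_ofReal)
    have h2 : ∀ x, liminf (fun n => ENNReal.ofReal (G n x)) atTop = ENNReal.ofReal (g x) :=
      fun x => ((ENNReal.continuous_ofReal.tendsto _).comp (hg x)).liminf_eq
    have h3 : liminf (fun n => ∫⁻ x, ENNReal.ofReal (G n x) ∂μ) atTop = ENNReal.ofReal c := by
      simp_rw [← ofReal_integral_eq_lintegral_ofReal (hi _) (ae_of_all _ (h0 _))]
      exact ((ENNReal.continuous_ofReal.tendsto _).comp hc).liminf_eq
    simp_rw [h2, h3] at h1
    exact h1
  have hint : Integrable g μ := by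
    refine ⟨hgm.aestronglyMeasurable, ?_⟩
    rw [hasFiniteIntegral_iff_ofReal (ae_of_all _ hg0)]
    exact key.trans_lt ENNReal.ofReal_lt_top
  refine ⟨hint, ?_⟩
  rw [← ENNReal.ofReal_le_ofReal_iff hc0, ofReal_integral_eq_lintegral_ofReal hint
    (ae_of_all _ hg0)]
  exact key

theorem inv_smul_mem_unitBox_abs {d : ℕ} {θ : Fin d → ℝ} (h : θ ∈ unitBox d) (i : Fin d) :
    |θ i| ≤ 1 / 2 := abs_le.mpr ⟨(h i trivial).1.le, (h i trivial).2⟩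

/-- The integrand on the torus, rescaled to `(-t/2, t/2]^d`. -/
def rescaledDensity (d k p : ℕ) (W : (Fin d → ℝ) → ℝ) (t : ℕ) (x : Fin d → ℝ) : ℝ :=
  Set.indicator ((t : ℝ) • unitBox d) (fun x =>
    (‖simplexExpSum d t ((t : ℝ)⁻¹ • x)‖ / (t : ℝ) ^ d) ^ (2 * k) *
      ((t : ℝ) ^ p * W ((t : ℝ)⁻¹ • x)) ^ 2) x

section Rescaled

variable {d k p D : ℕ} {W V F : (Fin d → ℝ) → ℝ}

theorem rescaledDensity_nonneg (t : ℕ) (x : Fin d → ℝ) : 0 ≤ rescaledDensity d k p W t x :=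
  Set.indicator_nonneg (fun _ _ => mul_nonneg (by positivity) (sq_nonneg _)) x

theorem measurable_rescaledDensity (hW : Continuous W) (t : ℕ) :
    Measurable (rescaledDensity d k p W t) := by
  refine Measurable.indicator ?_ ?_
  · have := continuous_simplexExpSum d t
    fun_prop
  · rcases Nat.eq_zero_or_pos t with rfl | ht
    · simp only [Nat.cast_zero]
      rcases (unitBox d).eq_empty_or_nonempty with h | h
      · rw [h, Set.smul_set_empty]
        exact MeasurableSet.empty
      · rw [Set.zero_smul_set h]
        exact measurableSet_singleton _
    · exact (measurableSet_unitBox d).const_smul_of_ne_zero (by positivity)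

theorem tendsto_rescaledDensity
    (hF : ∀ x, Tendsto (fun t : ℕ => ‖simplexExpSum d t ((t : ℝ)⁻¹ • x)‖ / (t : ℝ) ^ d) atTop
      (𝓝 (F x)))
    (hV : ∀ x, Tendsto (fun t : ℕ => (t : ℝ) ^ p * W ((t : ℝ)⁻¹ • x)) atTop (𝓝 (V x)))
    (x : Fin d → ℝ) :
    Tendsto (fun t => rescaledDensity d k p W t x) atTop (𝓝 (F x ^ (2 * k) * V x ^ 2)) := by
  refine (((hF x).pow (2 * k)).mul ((hV x).pow 2)).congr' ?_
  have h1 : ∀ i, ∀ᶠ t : ℕ in atTop, (t : ℝ)⁻¹ * x i ∈ Set.Ioc (-(1 / 2 : ℝ)) (1 / 2) := by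
    intro i
    have : Tendsto (fun t : ℕ => (t : ℝ)⁻¹ * x i) atTop (𝓝 (0 * x i)) :=
      (tendsto_inv_atTop_nhds_zero_nat).mul_const _
    rw [zero_mul] at this
    exact this.eventually (Ioc_mem_nhds (by norm_num) (by norm_num))
  filter_upwards [eventually_all.mpr h1, eventually_gt_atTop 0] with t ht h0
  have ht0 : (t : ℝ) ≠ 0 := by positivity
  rw [rescaledDensity, Set.indicator_of_mem]
  rw [Set.mem_smul_set_iff_inv_smul_mem₀ ht0]
  exact fun i _ => ht i

/-- Powers of `t`: `2 k d` from normalising the exponential sum, less `2 p` from the weight and `d`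
from the Jacobian, leaves `D`; this is `hexp`. -/
theorem setIntegral_rescaled (hexp : D + d + 2 * p = 2 * k * d) {t : ℕ} (ht : 0 < t)
    (κ : (Fin d → ℝ) → ℝ) :
    ∫ x in (t : ℝ) • unitBox d, (‖simplexExpSum d t ((t : ℝ)⁻¹ • x)‖ / (t : ℝ) ^ d) ^ (2 * k) *
      ((t : ℝ) ^ p * W ((t : ℝ)⁻¹ • x)) ^ 2 * κ ((t : ℝ)⁻¹ • x) =
    (∫ θ in unitBox d, ‖simplexExpSum d t θ‖ ^ (2 * k) * W θ ^ 2 * κ θ) / (t : ℝ) ^ D := by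
  have ht' : (0 : ℝ) < t := by positivity
  have h := Measure.setIntegral_comp_smul_of_pos (volume : Measure (Fin d → ℝ))
    (fun x => (‖simplexExpSum d t ((t : ℝ)⁻¹ • x)‖ / (t : ℝ) ^ d) ^ (2 * k) *
      ((t : ℝ) ^ p * W ((t : ℝ)⁻¹ • x)) ^ 2 * κ ((t : ℝ)⁻¹ • x)) (unitBox d) ht'
  simp only [inv_smul_smul₀ ht'.ne', Module.finrank_fintype_fun_eq_card, Fintype.card_fin,
    smul_eq_mul] at h
  have e : ∀ θ, (‖simplexExpSum d t θ‖ / (t : ℝ) ^ d) ^ (2 * k) * ((t : ℝ) ^ p * W θ) ^ 2 * κ θ =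
      ((t : ℝ) ^ (D + d))⁻¹ * (‖simplexExpSum d t θ‖ ^ (2 * k) * W θ ^ 2 * κ θ) := by
    intro θ
    have : ((t : ℝ) ^ d) ^ (2 * k) = (t : ℝ) ^ (D + d) * ((t : ℝ) ^ p) ^ 2 := by
      rw [← pow_mul, ← pow_mul, ← pow_add, mul_comm d, ← hexp]
      congr 1
      ring
    rw [div_pow, this]
    field_simp
  replace h := (integral_congr_ae (ae_of_all _ e)).symm.trans h
  rw [integral_const_mul, pow_add, mul_inv] at h
  have hd : ((t : ℝ) ^ d)⁻¹ ≠ 0 := by positivity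
  refine mul_left_cancel₀ hd (h.symm.trans ?_)
  rw [div_eq_mul_inv]
  ring

theorem integral_rescaledDensity (hexp : D + d + 2 * p = 2 * k * d) {t : ℕ} (ht : 0 < t) :
    ∫ x, rescaledDensity d k p W t x =
      (∫ θ in unitBox d, ‖simplexExpSum d t θ‖ ^ (2 * k) * W θ ^ 2) / (t : ℝ) ^ D := by
  have h := setIntegral_rescaled (W := W) hexp ht (fun _ => 1)
  simp only [mul_one] at h
  rw [← h, ← integral_indicator ((measurableSet_unitBox d).const_smul_of_ne_zero (by positivity))]
  rfl

theorem rescaledDensity_le {C : ℝ} {t : ℕ} (ht : 0 < t)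
    (hC : ∀ x : Fin d → ℝ, ((t : ℝ) ^ p * W ((t : ℝ)⁻¹ • x)) ^ 2 ≤
      C * ∏ j, (1 + |x j|) ^ (2 * k)) (x : Fin d → ℝ) :
    rescaledDensity d k p W t x ≤ (2 ^ d) ^ (2 * k) * (C * ∏ j, (1 + |x j|) ^ (2 * k)) := by
  have hC0 : 0 ≤ C * ∏ j, (1 + |x j|) ^ (2 * k) := (sq_nonneg _).trans (hC x)
  refine Set.indicator_apply_le' (fun _ => ?_) (fun _ => ?_)
  · refine mul_le_mul (pow_le_pow_left₀ (by positivity) ?_ _) (hC x) (sq_nonneg _) (by positivity)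
    rw [div_le_iff₀ (by positivity), ← mul_pow]
    refine (norm_simplexExpSum_le d t _).trans (pow_le_pow_left₀ (by positivity) ?_ _)
    have : (1 : ℝ) ≤ t := by exact_mod_cast ht
    linarith
  · exact mul_nonneg (by positivity) ((sq_nonneg _).trans (hC x))

/-- The dominating factor `∏_j min (1, A / (1 + x_j²))^(k + 1)`. -/
def decayFactor (d k : ℕ) (A : ℝ) (x : Fin d → ℝ) : ℝ :=
  ∏ j, (min 1 (A * (1 + x j ^ 2)⁻¹)) ^ (k + 1)

theorem decayFactor_nonneg {A : ℝ} (hA : 0 ≤ A) (x : Fin d → ℝ) : 0 ≤ decayFactor d k A x :=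
  Finset.prod_nonneg fun _ _ => by positivity

theorem decayFactor_le_one {A : ℝ} (hA : 0 ≤ A) (x : Fin d → ℝ) : decayFactor d k A x ≤ 1 :=
  Finset.prod_le_one (fun _ _ => by positivity) fun _ _ =>
    pow_le_one₀ (by positivity) (min_le_left _ _)

theorem continuous_decayFactor (d k : ℕ) (A : ℝ) : Continuous (decayFactor d k A) := by
  unfold decayFactor
  have : ∀ (j : Fin d), Continuous fun x : Fin d → ℝ => (1 + x j ^ 2)⁻¹ := fun j =>
    Continuous.inv₀ (by fun_prop) fun x => by positivity
  fun_prop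

/-- Since `(1 + |x|)² ≤ 2 (1 + x²)`, `k` of the `k + 1` decay factors absorb the growth. The
remaining one is integrable, which is why the exponent is `k + 1`. -/
theorem growth_mul_decayFactor_le {A : ℝ} (hA : 0 ≤ A) (x : Fin d → ℝ) :
    (∏ j, (1 + |x j|) ^ (2 * k)) * decayFactor d k A x ≤
      ((2 : ℝ) ^ k * A ^ (k + 1)) ^ d * ∏ j, (1 + x j ^ 2)⁻¹ := by
  have : ((2 : ℝ) ^ k * A ^ (k + 1)) ^ d = ∏ _j : Fin d, ((2 : ℝ) ^ k * A ^ (k + 1)) := by simp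
  rw [this, decayFactor, ← Finset.prod_mul_distrib, ← Finset.prod_mul_distrib]
  refine Finset.prod_le_prod (fun j _ => by positivity) fun j _ => ?_
  have h1 : (1 + |x j|) ^ 2 ≤ 2 * (1 + x j ^ 2) := by
    nlinarith [sq_nonneg (1 - |x j|), sq_abs (x j)]
  calc (1 + |x j|) ^ (2 * k) * min 1 (A * (1 + x j ^ 2)⁻¹) ^ (k + 1)
      ≤ (2 * (1 + x j ^ 2)) ^ k * (A * (1 + x j ^ 2)⁻¹) ^ (k + 1) := by
        rw [pow_mul]
        gcongr
        exact min_le_right _ _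
    _ = _ := by
        have h2 : (1 + x j ^ 2) ≠ 0 := by positivity
        have h3 : (1 + x j ^ 2) ^ k ≠ 0 := pow_ne_zero _ h2
        rw [mul_pow, mul_pow, inv_pow, pow_succ (1 + x j ^ 2)]
        field_simp

/-- At `u = x_j / t` and `M + 1 ≥ ε t`, `abs_mul_avgKernel_le` reads `|x_j| κ ≤ 1 / (2ε)`. With `κ ≤
1` this gives `κ² (1 + x_j²) ≤ 1 + (1 / (2ε))²`, a bound independent of `t`. -/
theorem prod_avgKernel_le_decayFactor {ε : ℝ} (hε : 0 < ε) {M t : ℕ} (ht : 0 < t)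
    (hM : ε * t ≤ M + 1) {x : Fin d → ℝ} (hx : (t : ℝ)⁻¹ • x ∈ unitBox d) :
    ∏ j, avgKernel M (((t : ℝ)⁻¹ • x) j) ^ (2 * (k + 1)) ≤
      decayFactor d k (1 + (1 / (2 * ε)) ^ 2) x := by
  refine Finset.prod_le_prod (fun j _ => pow_nonneg (avgKernel_nonneg _ _) _) fun j _ => ?_
  rw [pow_mul]
  refine pow_le_pow_left₀ (sq_nonneg _) ?_ _
  set κ := avgKernel M (((t : ℝ)⁻¹ • x) j) with hκ
  have h0 : 0 ≤ κ := avgKernel_nonneg _ _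
  have h1 : κ ≤ 1 := avgKernel_le_one _ _
  have h2 := abs_mul_avgKernel_le M (inv_smul_mem_unitBox_abs hx j)
  rw [← hκ, Pi.smul_apply, smul_eq_mul, abs_mul, abs_inv, Nat.abs_cast] at h2
  have ht' : (0 : ℝ) < t := by positivity
  have h3 : |x j| * κ ≤ 1 / (2 * ε) := by
    rw [le_div_iff₀ (by positivity)]
    calc |x j| * κ * (2 * ε) = 2 * ((t : ℝ)⁻¹ * |x j|) * (ε * t) * κ := by field_simp
      _ ≤ 2 * ((t : ℝ)⁻¹ * |x j|) * (M + 1) * κ := by gcongr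
      _ ≤ 1 := h2
  refine le_min (pow_le_one₀ h0 h1) ?_
  rw [← div_eq_mul_inv, le_div_iff₀ (by positivity)]
  have h4 : (|x j| * κ) ^ 2 ≤ (1 / (2 * ε)) ^ 2 := pow_le_pow_left₀ (by positivity) h3 _
  rw [mul_pow, sq_abs] at h4
  nlinarith

end Rescaled


/-! ### Exchange of limit and integral -/

/-- Passage to the limit in the moment identities on the torus. -/
theorem integrable_and_integral_limitDensity {d k p D q : ℕ} {W V F : (Fin d → ℝ) → ℝ}
    {L : ℕ → ℝ} {v K C : ℝ} (hexp : D + d + 2 * p = 2 * k * d) (hW : Continuous W)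
    (hF : ∀ x, Tendsto (fun t : ℕ => ‖simplexExpSum d t ((t : ℝ)⁻¹ • x)‖ / (t : ℝ) ^ d) atTop
      (𝓝 (F x)))
    (hV : ∀ x, Tendsto (fun t : ℕ => (t : ℝ) ^ p * W ((t : ℝ)⁻¹ • x)) atTop (𝓝 (V x)))
    (hC : ∀ t : ℕ, 0 < t → ∀ x : Fin d → ℝ, ((t : ℝ) ^ p * W ((t : ℝ)⁻¹ • x)) ^ 2 ≤
      C * ∏ j, (1 + |x j|) ^ (2 * k))
    (hL : Tendsto (fun t => L t / (t : ℝ) ^ D) atTop (𝓝 v))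
    (hA : ∀ t, ∫ θ in unitBox d, ‖simplexExpSum d t θ‖ ^ (2 * k) * W θ ^ 2 = K * L t)
    (hB : ∀ M t, q * M ≤ t → K * L (t - q * M) ≤ K * L t / 2 +
      (∫ θ in unitBox d, ‖simplexExpSum d t θ‖ ^ (2 * k) * W θ ^ 2 *
        ∏ j, avgKernel M (θ j) ^ (2 * (k + 1))) / 2) :
    Integrable (fun x => F x ^ (2 * k) * V x ^ 2) ∧
      ∫ x, F x ^ (2 * k) * V x ^ 2 = K * v := by
  set Φ := rescaledDensity d k p W with hΦ
  have hΦlim := tendsto_rescaledDensity (k := k) hF hV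
  have hint : ∀ t : ℕ, 0 < t → ∀ {g : (Fin d → ℝ) → ℝ}, Continuous g →
      IntegrableOn (fun x => (‖simplexExpSum d t ((t : ℝ)⁻¹ • x)‖ / (t : ℝ) ^ d) ^ (2 * k) *
      ((t : ℝ) ^ p * W ((t : ℝ)⁻¹ • x)) ^ 2 * g x) ((t : ℝ) • unitBox d) := by
    intro t ht g hg
    have hsub : (t : ℝ) • unitBox d ⊆ (t : ℝ) • Set.Icc (fun _ => -(1 / 2)) (fun _ => 1 / 2) :=
      Set.smul_set_mono fun x hx => ⟨fun i => (hx i trivial).1.le, fun i => (hx i trivial).2⟩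
    refine IntegrableOn.mono_set ?_ hsub
    have := continuous_simplexExpSum d t
    exact ContinuousOn.integrableOn_compact (isCompact_Icc.smul _)
      (Continuous.continuousOn (by fun_prop))
  have hms : ∀ t : ℕ, 0 < t → MeasurableSet ((t : ℝ) • unitBox d) := fun t ht =>
    (measurableSet_unitBox d).const_smul_of_ne_zero (by positivity)
  have hΦint : ∀ t : ℕ, 0 < t → Integrable (Φ t) := by
    intro t ht
    have h := hint t ht (g := fun _ => 1) continuous_const
    simp only [mul_one] at h
    exact (integrable_indicator_iff (hms t ht)).mpr h
  have hΦI : ∀ t : ℕ, 0 < t → ∫ x, Φ t x = K * (L t / (t : ℝ) ^ D) := fun t ht => by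
    rw [hΦ, integral_rescaledDensity hexp ht, hA, mul_div_assoc]
  -- Fatou: integrability and the upper bound. The index is shifted to `n + 1` to avoid dividing by
  -- `t = 0`.
  obtain ⟨h1, h2⟩ := integrable_and_integral_le_of_tendsto (μ := volume)
    (G := fun n => Φ (n + 1)) (g := fun x => F x ^ (2 * k) * V x ^ 2) (c := K * v)
    (fun n => measurable_rescaledDensity hW _) (fun n => rescaledDensity_nonneg _)
    (fun n => hΦint _ n.succ_pos) (fun x => (hΦlim x).comp (tendsto_add_atTop_nat 1)) (by
      simp_rw [hΦI _ (Nat.succ_pos _)]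
      exact (hL.const_mul K).comp (tendsto_add_atTop_nat 1))
  refine ⟨h1, le_antisymm h2 ?_⟩
  set I := ∫ x, F x ^ (2 * k) * V x ^ 2
  -- The limit of `hB` divided by `t ^ D` along `M = ⌊ε t⌋`. The damped integral converges by
  -- domination, and its limit is at most `I` because the damping factor is at most `1`.
  have key : ∀ ε : ℝ, 0 < ε → ε * (q + 1) ≤ 1 → K * (v * (1 - q * ε) ^ D) ≤ K * v / 2 + I / 2 := by
    intro ε hε hεq
    set A : ℝ := 1 + (1 / (2 * ε)) ^ 2 with hAdef
    have hA0 : 0 ≤ A := by positivity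
    set G := decayFactor d k A with hG
    have hlimG : Tendsto (fun n => ∫ x, Φ (n + 1) x * G x) atTop
        (𝓝 (∫ x, F x ^ (2 * k) * V x ^ 2 * G x)) := by
      refine tendsto_integral_of_dominated_convergence
        (fun x => (2 ^ d) ^ (2 * k) * (C * (((2 : ℝ) ^ k * A ^ (k + 1)) ^ d *
          ∏ j, (1 + x j ^ 2)⁻¹))) (fun n => ?_) ?_ (fun n => ae_of_all _ fun x => ?_)
        (ae_of_all _ fun x => ?_)
      · exact ((measurable_rescaledDensity hW _).mul
          (continuous_decayFactor d k A).measurable).aestronglyMeasurable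
      · refine ((Integrable.const_mul ?_ _).const_mul _).const_mul _
        exact Integrable.fintype_prod fun _ => integrable_inv_one_add_sq
      · have hC0 : 0 ≤ C := by
          have := (sq_nonneg _).trans (hC 1 one_pos 0)
          simpa using this
        rw [Real.norm_of_nonneg (mul_nonneg (rescaledDensity_nonneg _ _)
          (decayFactor_nonneg hA0 x))]
        calc Φ (n + 1) x * G x
            ≤ (2 ^ d) ^ (2 * k) * (C * ∏ j, (1 + |x j|) ^ (2 * k)) * G x :=
              mul_le_mul_of_nonneg_right (rescaledDensity_le n.succ_pos (hC _ n.succ_pos) x)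
                (decayFactor_nonneg hA0 x)
          _ = (2 ^ d) ^ (2 * k) * (C * ((∏ j, (1 + |x j|) ^ (2 * k)) * G x)) := by ring
          _ ≤ _ := mul_le_mul_of_nonneg_left (mul_le_mul_of_nonneg_left
              (growth_mul_decayFactor_le hA0 x) hC0) (by positivity)
      · exact ((hΦlim x).comp (tendsto_add_atTop_nat 1)).mul_const _
    have hIG : ∫ x, F x ^ (2 * k) * V x ^ 2 * G x ≤ I := by
      refine integral_mono_of_nonneg (ae_of_all _ fun x => ?_) h1 (ae_of_all _ fun x => ?_)
      · exact mul_nonneg (mul_nonneg (by rw [pow_mul]; positivity) (sq_nonneg _))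
          (decayFactor_nonneg hA0 x)
      · exact mul_le_of_le_one_right (mul_nonneg (by rw [pow_mul]; positivity) (sq_nonneg _))
          (decayFactor_le_one hA0 x)
    let M : ℕ → ℕ := fun n => ⌊ε * ((n + 1 : ℕ) : ℝ)⌋₊
    -- The factor `q + 1`, rather than `q`, leaves `t - q M ≥ M`, so that `t - q M` tends to
    -- infinity with `t`.
    have hMle : ∀ n, (q + 1) * M n ≤ n + 1 := by
      intro n
      have h3 : (M n : ℝ) ≤ ε * ((n + 1 : ℕ) : ℝ) := Nat.floor_le (by positivity)
      have h4 : ((q + 1 : ℕ) : ℝ) * M n ≤ ((n + 1 : ℕ) : ℝ) := by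
        calc ((q + 1 : ℕ) : ℝ) * M n ≤ ((q + 1 : ℕ) : ℝ) * (ε * ((n + 1 : ℕ) : ℝ)) := by gcongr
          _ = (ε * (q + 1)) * ((n + 1 : ℕ) : ℝ) := by push_cast; ring
          _ ≤ 1 * ((n + 1 : ℕ) : ℝ) := by gcongr
          _ = _ := one_mul _
      exact_mod_cast h4
    have hqM : ∀ n, q * M n ≤ n + 1 := fun n =>
      (Nat.mul_le_mul_right _ (Nat.le_succ q)).trans (hMle n)
    have hbound : ∀ n : ℕ, K * (L (n + 1 - q * M n) / ((n + 1 : ℕ) : ℝ) ^ D) ≤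
        K * (L (n + 1) / ((n + 1 : ℕ) : ℝ) ^ D) / 2 + (∫ x, Φ (n + 1) x * G x) / 2 := by
      intro n
      have hpos : (0 : ℝ) < ((n + 1 : ℕ) : ℝ) ^ D := by positivity
      have h5 := div_le_div_of_nonneg_right (hB (M n) (n + 1) (hqM n)) hpos.le
      rw [add_div, div_right_comm, div_right_comm (∫ _ in _, _),
        ← setIntegral_rescaled (W := W) hexp n.succ_pos
          (fun θ => ∏ j, avgKernel (M n) (θ j) ^ (2 * (k + 1))),
        mul_div_assoc, mul_div_assoc] at h5
      refine h5.trans (add_le_add_right (div_le_div_of_nonneg_right ?_ (by norm_num)) _)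
      have e : ∫ x, Φ (n + 1) x * G x = ∫ x in ((n + 1 : ℕ) : ℝ) • unitBox d,
          (‖simplexExpSum d (n + 1) (((n + 1 : ℕ) : ℝ)⁻¹ • x)‖ / ((n + 1 : ℕ) : ℝ) ^ d) ^ (2 * k) *
      (((n + 1 : ℕ) : ℝ) ^ p * W (((n + 1 : ℕ) : ℝ)⁻¹ • x)) ^ 2 * G x := by
        rw [← integral_indicator (hms _ n.succ_pos)]
        congr 1
        ext x
        by_cases hx : x ∈ ((n + 1 : ℕ) : ℝ) • unitBox d
        · rw [hΦ, rescaledDensity, Set.indicator_of_mem hx, Set.indicator_of_mem hx]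
        · rw [hΦ, rescaledDensity, Set.indicator_of_notMem hx, Set.indicator_of_notMem hx, zero_mul]
      rw [e]
      refine setIntegral_mono_on (hint _ n.succ_pos (by fun_prop))
        (hint _ n.succ_pos (continuous_decayFactor d k A)) (hms _ n.succ_pos) fun x hx => ?_
      refine mul_le_mul_of_nonneg_left ?_ (mul_nonneg (by positivity) (sq_nonneg _))
      refine prod_avgKernel_le_decayFactor hε n.succ_pos (Nat.lt_floor_add_one _).le ?_
      exact (Set.mem_smul_set_iff_inv_smul_mem₀ (by positivity) _ _).mp hx
    have hMlim : Tendsto (fun n : ℕ => (M n : ℝ) / ((n + 1 : ℕ) : ℝ)) atTop (𝓝 ε) :=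
      (tendsto_nat_floor_mul_div_atTop hε.le).comp
        (tendsto_natCast_atTop_atTop.comp (tendsto_add_atTop_nat 1))
    have hsub : Tendsto (fun n => n + 1 - q * M n) atTop atTop := by
      have h6 : Tendsto (fun n : ℕ => ⌊ε * ((n + 1 : ℕ) : ℝ)⌋₊) atTop atTop :=
        tendsto_nat_floor_atTop.comp ((tendsto_natCast_atTop_atTop.comp
          (tendsto_add_atTop_nat 1)).const_mul_atTop hε)
      refine tendsto_atTop_mono (fun n => ?_) h6
      have := hMle n
      rw [Nat.add_mul, one_mul] at this
      change M n ≤ _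
      omega
    have hlimL : Tendsto (fun n : ℕ => K * (L (n + 1 - q * M n) / ((n + 1 : ℕ) : ℝ) ^ D)) atTop
        (𝓝 (K * (v * (1 - q * ε) ^ D))) := by
      refine Tendsto.const_mul K ?_
      have h7 := (hL.comp hsub).mul (((hMlim.const_mul (q : ℝ)).const_sub 1).pow D)
      refine h7.congr' ?_
      filter_upwards [hsub.eventually_gt_atTop 0] with n hn
      have h8 : ((n + 1 - q * M n : ℕ) : ℝ) = ((n + 1 : ℕ) : ℝ) - q * M n := by
        rw [Nat.cast_sub (hqM n)]
        push_cast
        ring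
      have h9 : (0 : ℝ) < ((n + 1 - q * M n : ℕ) : ℝ) := by exact_mod_cast hn
      have h10 : (0 : ℝ) < ((n + 1 : ℕ) : ℝ) := by positivity
      have h11 : 1 - (q : ℝ) * (M n / ((n + 1 : ℕ) : ℝ)) =
          ((n + 1 - q * M n : ℕ) : ℝ) / ((n + 1 : ℕ) : ℝ) := by
        rw [h8]
        field_simp
      rw [Function.comp_apply, h11, div_pow]
      field_simp
    have hR := (((hL.comp (tendsto_add_atTop_nat 1)).const_mul K).div_const 2).add
      (hlimG.div_const 2)
    refine (le_of_tendsto_of_tendsto' hlimL hR hbound).trans ?_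
    linarith
  -- A sequence of admissible `ε` tending to `0`; in the limit `K v ≤ K v / 2 + I / 2`, that is `K v
  -- ≤ I`.
  have hε : Tendsto (fun n : ℕ => 1 / (((q + 1 : ℕ) : ℝ) * ((n : ℝ) + 1))) atTop (𝓝 0) := by
    have := (tendsto_one_div_add_atTop_nhds_zero_nat (𝕜 := ℝ)).const_mul (((q + 1 : ℕ) : ℝ)⁻¹)
    rw [mul_zero] at this
    refine this.congr fun n => ?_
    rw [one_div, one_div, mul_inv]
  have hlim := ((((hε.const_mul (q : ℝ)).const_sub 1).pow D).const_mul v).const_mul K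
  have hfin := le_of_tendsto' hlim fun n => key _ (by positivity) (by
    rw [div_mul_eq_mul_div, div_le_one (by positivity)]
    push_cast
    have : (0 : ℝ) ≤ n := Nat.cast_nonneg n
    have : (0 : ℝ) ≤ q := Nat.cast_nonneg q
    nlinarith)
  simp only [mul_zero, sub_zero, one_pow, mul_one] at hfin
  linarith


/-! ### Riemann sums over the solid simplex and its Fourier transform -/

theorem mem_inv_smul_span_iff {ι : Type*} [Finite ι] {t : ℕ} (ht : 0 < t) {v : ι → ℝ} :
    v ∈ (t : ℝ)⁻¹ • (Submodule.span ℤ (Set.range (Pi.basisFun ℝ ι)) : Set (ι → ℝ)) ↔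
      ∃ a : ι → ℤ, v = fun i => (t : ℝ)⁻¹ * a i := by
  have : NeZero t := ⟨ht.ne'⟩
  have ht' : (t : ℝ) ≠ 0 := by positivity
  rw [← Submodule.coe_pointwise_smul, SetLike.mem_coe,
    BoxIntegral.unitPartition.mem_smul_span_iff]
  constructor
  · intro h
    choose a ha using h
    refine ⟨a, funext fun i => ?_⟩
    have := ha i
    simp only [algebraMap_int_eq, eq_intCast] at this
    rw [this, inv_mul_cancel_left₀ ht']
  · rintro ⟨a, rfl⟩ i
    exact ⟨a i, by simp [mul_inv_cancel_left₀ ht']⟩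

/-- The solid standard simplex. -/
def solidSimplex (d : ℕ) : Set (Fin d → ℝ) := {s | (∀ j, 0 ≤ s j) ∧ ∑ j, s j ≤ 1}

theorem isClosed_solidSimplex (d : ℕ) : IsClosed (solidSimplex d) := by
  refine IsClosed.inter (s₁ := {s : Fin d → ℝ | ∀ j, 0 ≤ s j}) ?_
    (isClosed_le (f := fun s : Fin d → ℝ => ∑ j, s j) (by fun_prop) continuous_const)
  simp only [Set.ofPred_forall]
  exact isClosed_iInter fun j => isClosed_le continuous_const (continuous_apply j)

theorem convex_solidSimplex (d : ℕ) : Convex ℝ (solidSimplex d) := by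
  rintro x ⟨hx, hx'⟩ y ⟨hy, hy'⟩ a b ha hb hab
  refine ⟨fun j => ?_, ?_⟩
  · simp only [Pi.add_apply, Pi.smul_apply, smul_eq_mul]
    exact add_nonneg (mul_nonneg ha (hx j)) (mul_nonneg hb (hy j))
  · simp only [Pi.add_apply, Pi.smul_apply, smul_eq_mul, Finset.sum_add_distrib,
      ← Finset.mul_sum]
    nlinarith

theorem solidSimplex_subset_Icc (d : ℕ) : solidSimplex d ⊆ Set.Icc 0 1 := fun _ hs =>
  ⟨hs.1, fun j => (Finset.single_le_sum (fun i _ => hs.1 i) (Finset.mem_univ j)).trans hs.2⟩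

/-- The simplex is convex, so its frontier is a null set and the Riemann sums over `t⁻¹ ℤ^d`
converge. -/
theorem tendsto_simplex_riemannSum (d : ℕ) {f : (Fin d → ℝ) → ℝ} (hf : Continuous f) :
    Tendsto (fun t : ℕ =>
      (∑ a ∈ (Fintype.piFinset fun _ : Fin d => Finset.range (t + 1)) with ∑ j, a j ≤ t,
        f (fun j => (t : ℝ)⁻¹ * a j)) / (t : ℝ) ^ d) atTop (𝓝 (∫ s in solidSimplex d, f s)) := by
  classical
  have h := tendsto_tsum_div_pow_atTop_integral (solidSimplex d) f hf
    (Metric.isBounded_Icc 0 1 |>.subset (solidSimplex_subset_Icc d))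
    (isClosed_solidSimplex d).measurableSet ((convex_solidSimplex d).addHaar_frontier _)
  rw [Fintype.card_fin] at h
  refine h.congr' ?_
  filter_upwards [eventually_gt_atTop 0] with t ht
  have ht' : (0 : ℝ) < t := by positivity
  congr 1
  have hS : solidSimplex d ∩ (t : ℝ)⁻¹ •
      (Submodule.span ℤ (Set.range (Pi.basisFun ℝ (Fin d))) : Set (Fin d → ℝ)) =
      ↑(((Fintype.piFinset fun _ : Fin d => Finset.range (t + 1)).filter
        fun a => ∑ j, a j ≤ t).image fun a j => (t : ℝ)⁻¹ * (a j : ℝ)) := by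
    ext v
    rw [Set.mem_inter_iff, mem_inv_smul_span_iff ht]
    simp only [Finset.coe_image, Set.mem_image, Finset.mem_coe, Finset.mem_filter,
      Fintype.mem_piFinset, Finset.mem_range, solidSimplex, Set.mem_ofPred_eq]
    constructor
    · rintro ⟨⟨h0, h1⟩, a, rfl⟩
      have ha : ∀ j, 0 ≤ a j := fun j => by
        have := (mul_nonneg_iff_of_pos_left (inv_pos.mpr ht')).mp (h0 j)
        exact_mod_cast this
      lift a to Fin d → ℕ using ha
      rw [← Finset.mul_sum, inv_mul_le_iff₀ ht', mul_one] at h1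
      have h2 : ∑ j, a j ≤ t := by exact_mod_cast h1
      exact ⟨a, ⟨fun j => Nat.lt_succ_of_le ((Finset.single_le_sum (fun _ _ => Nat.zero_le _)
        (Finset.mem_univ j)).trans h2), h2⟩, by simp⟩
    · rintro ⟨a, ⟨-, h2⟩, rfl⟩
      refine ⟨⟨fun j => by positivity, ?_⟩, fun j => a j, by simp⟩
      rw [← Finset.mul_sum, inv_mul_le_iff₀ ht', mul_one]
      exact_mod_cast h2
  rw [hS, Finset.tsum_subtype' _ f, Finset.sum_image]
  intro a _ b _ hab
  ext j
  have := congrFun hab j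
  simpa [ht'.ne'] using this

/-- The Fourier transform of the indicator of the solid simplex. -/
def simplexFourier (d : ℕ) (x : Fin d → ℝ) : ℂ := ∫ s in solidSimplex d, phase (∑ j, s j * x j)

theorem integrableOn_simplex_phase {d : ℕ} (x : Fin d → ℝ) :
    IntegrableOn (fun s : Fin d → ℝ => phase (∑ j, s j * x j)) (solidSimplex d) :=
  (ContinuousOn.integrableOn_compact isCompact_Icc
    (Continuous.continuousOn (by fun_prop))).mono_set (solidSimplex_subset_Icc d)

theorem tendsto_simplexExpSum (d : ℕ) (x : Fin d → ℝ) :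
    Tendsto (fun t : ℕ => simplexExpSum d t ((t : ℝ)⁻¹ • x) / (t : ℂ) ^ d) atTop
      (𝓝 (simplexFourier d x)) := by
  have hre := tendsto_simplex_riemannSum d
    (f := fun s => (phase (∑ j, s j * x j)).re) (by fun_prop)
  have him := tendsto_simplex_riemannSum d
    (f := fun s => (phase (∑ j, s j * x j)).im) (by fun_prop)
  have e1 : ∫ s in solidSimplex d, (phase (∑ j, s j * x j)).re = (simplexFourier d x).re :=
    integral_re (𝕜 := ℂ) (integrableOn_simplex_phase x)
  have e2 : ∫ s in solidSimplex d, (phase (∑ j, s j * x j)).im = (simplexFourier d x).im :=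
    integral_im (𝕜 := ℂ) (integrableOn_simplex_phase x)
  rw [e1] at hre
  rw [e2] at him
  have h := ((Complex.continuous_ofReal.tendsto _).comp hre).add
    (((Complex.continuous_ofReal.tendsto _).comp him).mul_const Complex.I)
  rw [Complex.re_add_im] at h
  refine h.congr fun t => ?_
  simp only [Function.comp_apply]
  rw [simplexExpSum_eq_sum]
  push_cast
  rw [← mul_div_right_comm, ← add_div, Finset.sum_mul, ← Finset.sum_add_distrib]
  congr 1
  refine Finset.sum_congr rfl fun a _ => ?_
  rw [Complex.re_add_im]
  congr 1
  refine Finset.sum_congr rfl fun j _ => ?_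
  rw [Pi.smul_apply, smul_eq_mul]
  ring

theorem tendsto_norm_simplexExpSum (d : ℕ) (x : Fin d → ℝ) :
    Tendsto (fun t : ℕ => ‖simplexExpSum d t ((t : ℝ)⁻¹ • x)‖ / (t : ℝ) ^ d) atTop
      (𝓝 ‖simplexFourier d x‖) :=
  (tendsto_simplexExpSum d x).norm.congr fun t => by simp

theorem integral_Icc_phase (a : ℝ) :
    ∫ s in Set.Icc (0 : ℝ) 1, phase (s * a) = phase (a / 2) * (Real.sinc (Real.pi * a) : ℝ) := by
  rw [integral_Icc_eq_integral_Ioc, ← intervalIntegral.integral_of_le zero_le_one]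
  by_cases ha : a = 0
  · simp [ha]
  · have hc : (2 * Real.pi * a * Complex.I : ℂ) ≠ 0 := by
      simp [Real.pi_ne_zero, ha]
    have e : ∀ s : ℝ, phase (s * a) = Complex.exp ((2 * Real.pi * a * Complex.I : ℂ) * s) := by
      intro s
      rw [phase]
      congr 1
      push_cast
      ring
    simp_rw [e]
    rw [integral_exp_mul_complex hc, Real.sinc_of_ne_zero (by positivity), phase, div_eq_iff hc]
    have h1 : Complex.exp ((2 * Real.pi * (a / 2) : ℝ) * Complex.I) =
        Complex.exp (Real.pi * a * Complex.I) := by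
      congr 1
      push_cast
      ring
    have h2 : Complex.exp (2 * Real.pi * a * Complex.I * (1 : ℝ)) =
        Complex.exp (Real.pi * a * Complex.I) * Complex.exp (Real.pi * a * Complex.I) := by
      rw [← Complex.exp_add]
      congr 1
      push_cast
      ring
    have h3 : Complex.exp (Real.pi * a * Complex.I) * Complex.exp (-(Real.pi * a) * Complex.I) =
        1 := by
      rw [← Complex.exp_add]
      simp
    rw [h1, h2]
    push_cast
    rw [Complex.sin]
    have ha' : (a : ℂ) ≠ 0 := by exact_mod_cast ha
    have h4 : ∀ E E' : ℂ, E * ((E' - E) * Complex.I / 2 / (Real.pi * a)) *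
        (2 * Real.pi * a * Complex.I) = (E * E' - E * E) * Complex.I ^ 2 := by
      intro E E'
      field_simp
    rw [h4, h3, Complex.I_sq]
    simp


/-! ### The sinc integral by Fourier inversion -/

section SincIntegral

variable {d : ℕ} (x : Fin d → ℝ)

/-- The slab kernel `e^{2πi s·x} 1_{[0,1]}(∑ s_j + w)`. -/
def slabKernel (w : ℝ) (s : Fin d → ℝ) : ℂ :=
  phase (∑ j, s j * x j) * Set.indicator (Set.Icc (0 : ℝ) 1) (fun _ => (1 : ℂ)) (∑ j, s j + w)

/-- The integral of the slab kernel over the unit cube. -/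
def slabIntegral (w : ℝ) : ℂ := ∫ s in Set.Icc (0 : Fin d → ℝ) 1, slabKernel x w s

theorem measurable_slabKernel : Measurable (Function.uncurry (slabKernel x)) := by
  unfold Function.uncurry slabKernel
  refine Measurable.mul ?_ ?_
  · exact Continuous.measurable (by fun_prop)
  · exact (measurable_const.indicator measurableSet_Icc).comp (by fun_prop)

theorem norm_indicator_Icc_le (u : ℝ) :
    ‖Set.indicator (Set.Icc (0 : ℝ) 1) (fun _ => (1 : ℂ)) u‖ ≤ 1 := by
  refine (norm_indicator_le_norm_self _ _).trans ?_
  simp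

theorem norm_slabKernel_le (w : ℝ) (s : Fin d → ℝ) : ‖slabKernel x w s‖ ≤ 1 := by
  rw [slabKernel, norm_mul, norm_phase, one_mul]
  exact norm_indicator_Icc_le _

/-- For `s` in the cube the sum of coordinates lies in `[0, d]`, so the kernel vanishes unless `w ∈
[-d, 1]`. -/
theorem integrable_slabKernel : Integrable (Function.uncurry (slabKernel x))
    ((volume : Measure ℝ).prod (volume.restrict (Set.Icc (0 : Fin d → ℝ) 1))) := by
  have : IsFiniteMeasure ((volume : Measure (Fin d → ℝ)).restrict (Set.Icc (0 : Fin d → ℝ) 1)) :=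
    ⟨by simpa using isCompact_Icc.measure_lt_top⟩
  have hg : Integrable (fun z : ℝ × (Fin d → ℝ) =>
      Set.indicator (Set.Icc (-(d : ℝ)) 1) (fun _ => (1 : ℝ)) z.1 * (1 : ℝ))
      ((volume : Measure ℝ).prod (volume.restrict (Set.Icc (0 : Fin d → ℝ) 1))) :=
    Integrable.mul_prod (f := Set.indicator (Set.Icc (-(d : ℝ)) 1) fun _ => (1 : ℝ))
      (g := fun _ => (1 : ℝ)) ((integrable_indicator_iff measurableSet_Icc).mpr
        (continuousOn_const.integrableOn_compact isCompact_Icc)) (integrable_const 1)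
  refine hg.mono' (measurable_slabKernel x).aestronglyMeasurable ?_
  have hs : ∀ᵐ s ∂((volume : Measure (Fin d → ℝ)).restrict (Set.Icc (0 : Fin d → ℝ) 1)),
      s ∈ Set.Icc (0 : Fin d → ℝ) 1 := ae_restrict_mem measurableSet_Icc
  have hs2 := (Measure.quasiMeasurePreserving_snd (μ := (volume : Measure ℝ))).ae hs
  filter_upwards [hs2] with z hz
  obtain ⟨w, s⟩ := z
  simp only [Function.uncurry_apply_pair, mul_one]
  by_cases hw : w ∈ Set.Icc (-(d : ℝ)) 1
  · rw [Set.indicator_of_mem hw]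
    exact norm_slabKernel_le x w s
  · have h0 : 0 ≤ ∑ j, s j := Finset.sum_nonneg fun j _ => hz.1 j
    have h1 : ∑ j, s j ≤ d := by
      calc ∑ j, s j ≤ ∑ _j : Fin d, (1 : ℝ) := Finset.sum_le_sum fun j _ => hz.2 j
        _ = d := by simp
    have : ∑ j, s j + w ∉ Set.Icc (0 : ℝ) 1 := fun h => hw ⟨by linarith [h.1], by linarith [h.2]⟩
    rw [Set.indicator_of_notMem hw, slabKernel, Set.indicator_of_notMem this]
    simp

theorem integrable_slabIntegral : Integrable (slabIntegral x) :=
  (integrable_slabKernel x).integral_prod_left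

/-- At `w = 0` the slab cuts the simplex out of the cube; the simplex transform is thus the value at
`0` of a function of `w` with explicit Fourier transform. -/
theorem slabIntegral_zero : slabIntegral x 0 = simplexFourier d x := by
  have e : ∀ s : Fin d → ℝ, slabKernel x 0 s =
      Set.indicator {s : Fin d → ℝ | ∑ j, s j ∈ Set.Icc (0 : ℝ) 1}
        (fun s => phase (∑ j, s j * x j)) s := by
    intro s
    rw [slabKernel, add_zero]
    by_cases h : ∑ j, s j ∈ Set.Icc (0 : ℝ) 1
    · rw [Set.indicator_of_mem h, Set.indicator_of_mem (by exact h), mul_one]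
    · rw [Set.indicator_of_notMem h, Set.indicator_of_notMem (by exact h), mul_zero]
  have hm : MeasurableSet {s : Fin d → ℝ | ∑ j, s j ∈ Set.Icc (0 : ℝ) 1} :=
    measurableSet_Icc.preimage (by fun_prop)
  rw [slabIntegral]
  simp_rw [e]
  rw [setIntegral_indicator hm, simplexFourier]
  congr 2
  ext s
  constructor
  · rintro ⟨h1, h2⟩
    exact ⟨h1.1, h2.2⟩
  · intro h
    exact ⟨solidSimplex_subset_Icc d h, Finset.sum_nonneg fun j _ => h.1 j, h.2⟩

theorem volume_sum_eq (hd : 0 < d) (c : ℝ) : volume {s : Fin d → ℝ | ∑ j, s j = c} = 0 := by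
  let ℓ : (Fin d → ℝ) →ₗ[ℝ] ℝ := ∑ j, LinearMap.proj j
  have hℓ : ∀ s, ℓ s = ∑ j, s j := fun s => by simp [ℓ]
  have hker : volume (LinearMap.ker ℓ : Set (Fin d → ℝ)) = 0 := by
    refine Measure.addHaar_submodule _ _ fun h => ?_
    have h1 : Pi.single (⟨0, hd⟩ : Fin d) (1 : ℝ) ∈ LinearMap.ker ℓ := h ▸ Submodule.mem_top
    rw [LinearMap.mem_ker, hℓ] at h1
    simp at h1
  have : {s : Fin d → ℝ | ∑ j, s j = c} =
      (fun s => s + Pi.single (⟨0, hd⟩ : Fin d) (-c)) ⁻¹' (LinearMap.ker ℓ : Set (Fin d → ℝ)) := by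
    ext s
    simp only [Set.mem_ofPred_eq, Set.mem_preimage, SetLike.mem_coe, LinearMap.mem_ker, hℓ,
      Pi.add_apply, Finset.sum_add_distrib, Finset.sum_pi_single', Finset.mem_univ, if_true]
    constructor <;> intro h <;> linarith
  rw [this, measure_preimage_add_right, hker]

/-- Pointwise inversion at `0` needs continuity there. The kernel can jump at `w = 0` only where `∑
s_j` is `0` or `1`, and these hyperplanes are null when `d > 0`. -/
theorem continuousAt_slabIntegral (hd : 0 < d) : ContinuousAt (slabIntegral x) 0 := by
  have : IsFiniteMeasure ((volume : Measure (Fin d → ℝ)).restrict (Set.Icc (0 : Fin d → ℝ) 1)) :=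
    ⟨by simpa using isCompact_Icc.measure_lt_top⟩
  refine continuousAt_of_dominated (bound := fun _ => 1) (Eventually.of_forall fun w => ?_)
    (Eventually.of_forall fun w => ae_of_all _ fun s => norm_slabKernel_le x w s)
    (integrable_const 1) ?_
  · exact ((measurable_slabKernel x).comp measurable_prodMk_left).aestronglyMeasurable
  · have h0 : ∀ᵐ s : Fin d → ℝ, ∑ j, s j ≠ 0 := by
      rw [ae_iff]
      simpa using volume_sum_eq hd 0
    have h1 : ∀ᵐ s : Fin d → ℝ, ∑ j, s j ≠ 1 := by
      rw [ae_iff]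
      simpa using volume_sum_eq hd 1
    filter_upwards [ae_restrict_of_ae h0, ae_restrict_of_ae h1] with s hs0 hs1
    unfold slabKernel
    refine ContinuousAt.mul continuousAt_const ?_
    have hc : ContinuousAt (Set.indicator (Set.Icc (0 : ℝ) 1) fun _ => (1 : ℂ))
        (∑ j, s j + 0) := by
      rw [add_zero]
      by_cases h : ∑ j, s j ∈ Set.Icc (0 : ℝ) 1
      · refine (continuousAt_const (y := (1 : ℂ))).congr ?_
        filter_upwards [Icc_mem_nhds (h.1.lt_of_ne' hs0) (h.2.lt_of_ne hs1)] with u hu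
        rw [Set.indicator_of_mem hu]
      · refine (continuousAt_const (y := (0 : ℂ))).congr ?_
        filter_upwards [isClosed_Icc.isOpen_compl.mem_nhds h] with u hu
        rw [Set.indicator_of_notMem hu]
    exact ContinuousAt.comp (f := fun w : ℝ => ∑ j, s j + w) hc (by fun_prop)

theorem integral_cube_phase (y : ℝ) :
    ∫ s in Set.Icc (0 : Fin d → ℝ) 1, phase (∑ j, s j * (x j + y)) =
      ∏ j, (phase ((x j + y) / 2) * (Real.sinc (Real.pi * (x j + y)) : ℝ)) := by
  simp_rw [phase_sum]
  rw [← Set.pi_univ_Icc, volume_pi, Measure.restrict_pi_pi,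
    integral_fintype_prod_eq_prod (fun j u => phase (u * (x j + y)))]
  exact Finset.prod_congr rfl fun j _ => integral_Icc_phase _

-- By Fubini, the `w`-integral for fixed `s` is that of a translated unit interval and gives the
-- sinc factor in `y`. The translation phase turns `x_j` into `x_j + y`, and the cube integral
-- splits into coordinates.
open FourierTransform in
theorem fourier_slabIntegral (y : ℝ) :
    𝓕 (slabIntegral x) y = (phase (-y / 2) * (Real.sinc (Real.pi * -y) : ℝ)) *
      ∏ j, (phase ((x j + y) / 2) * (Real.sinc (Real.pi * (x j + y)) : ℝ)) := by
  have h1 : 𝓕 (slabIntegral x) y = ∫ w : ℝ, ∫ s in Set.Icc (0 : Fin d → ℝ) 1,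
      phase (-(w * y)) * slabKernel x w s := by
    rw [Real.fourier_real_eq_integral_exp_smul]
    congr 1
    ext w
    rw [integral_const_mul, smul_eq_mul, slabIntegral]
    congr 2
    rw [mul_assoc, neg_mul, neg_mul, mul_neg]
  have hi : Integrable (Function.uncurry fun w s => phase (-(w * y)) * slabKernel x w s)
      ((volume : Measure ℝ).prod (volume.restrict (Set.Icc (0 : Fin d → ℝ) 1))) := by
    refine (integrable_slabKernel x).bdd_mul (f := fun z : ℝ × (Fin d → ℝ) => phase (-(z.1 * y)))
      (c := 1) ?_ (ae_of_all _ fun z => by simp)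
    exact Continuous.aestronglyMeasurable (by fun_prop)
  have h2 : ∀ s : Fin d → ℝ, ∫ w : ℝ, phase (-(w * y)) * slabKernel x w s =
      (phase (-y / 2) * (Real.sinc (Real.pi * -y) : ℝ)) * phase (∑ j, s j * (x j + y)) := by
    intro s
    have e : ∀ w : ℝ, phase (-(w * y)) * slabKernel x w s =
        phase (∑ j, s j * (x j + y)) * Set.indicator (Set.Icc (0 : ℝ) 1)
          (fun u => phase (u * -y)) (∑ j, s j + w) := by
      intro w
      rw [slabKernel]
      by_cases h : ∑ j, s j + w ∈ Set.Icc (0 : ℝ) 1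
      · rw [Set.indicator_of_mem h, Set.indicator_of_mem h, mul_one, ← phase_add, ← phase_add]
        congr 1
        simp only [mul_add, Finset.sum_add_distrib, ← Finset.sum_mul]
        ring
      · rw [Set.indicator_of_notMem h, Set.indicator_of_notMem h]
        simp
    simp_rw [e]
    rw [integral_const_mul, integral_add_left_eq_self (μ := volume)
      (Set.indicator (Set.Icc (0 : ℝ) 1) (fun u => phase (u * -y))),
      integral_indicator measurableSet_Icc, integral_Icc_phase, mul_comm]
  rw [h1, integral_integral_swap hi]
  simp_rw [h2]
  rw [integral_const_mul, integral_cube_phase]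

theorem sinc_sq_le (v : ℝ) : Real.sinc v ^ 2 ≤ 2 * (1 + v ^ 2)⁻¹ := by
  rw [← div_eq_mul_inv, le_div_iff₀ (by positivity)]
  have h1 := Real.abs_sinc_le_one v
  have h2 : |v * Real.sinc v| ≤ 1 := by
    by_cases hv : v = 0
    · simp [hv]
    · rw [Real.sinc_of_ne_zero hv, mul_div_cancel₀ _ hv]
      exact Real.abs_sin_le_one v
  have h3 := (sq_le_one_iff_abs_le_one _).mpr h1
  have h4 := (sq_le_one_iff_abs_le_one _).mpr h2
  nlinarith

theorem integrable_sinc_sq (a : ℝ) : Integrable fun y : ℝ => Real.sinc (Real.pi * (a + y)) ^ 2 := by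
  have h1 : Integrable fun y : ℝ => 2 * (1 + (Real.pi * (a + y)) ^ 2)⁻¹ :=
    ((integrable_inv_one_add_sq.comp_mul_left' Real.pi_ne_zero).comp_add_left a).const_mul 2
  refine h1.mono' ?_ (ae_of_all _ fun y => ?_)
  · have := Real.continuous_sinc
    exact Continuous.aestronglyMeasurable (by fun_prop)
  · rw [Real.norm_of_nonneg (sq_nonneg _)]
    exact sinc_sq_le _

-- Two sinc factors suffice: their product is at most the mean of two integrable squares. The second
-- exists because `d > 0`.
open FourierTransform in
theorem integrable_fourier_slabIntegral (hd : 0 < d) : Integrable (𝓕 (slabIntegral x)) := by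
  rw [funext (fourier_slabIntegral x)]
  have hcs := Real.continuous_sinc
  refine (((integrable_sinc_sq 0).add (integrable_sinc_sq (x ⟨0, hd⟩))).div_const 2).mono'
    (Continuous.aestronglyMeasurable (by fun_prop)) (ae_of_all _ fun y => ?_)
  simp only [Pi.add_apply]
  rw [norm_mul, norm_prod]
  simp only [norm_mul, norm_phase, one_mul, Complex.norm_real, Real.norm_eq_abs]
  rw [← Finset.mul_prod_erase _ _ (Finset.mem_univ (⟨0, hd⟩ : Fin d)), mul_neg, Real.sinc_neg,
    zero_add]
  have h1 : ∏ j ∈ Finset.univ.erase (⟨0, hd⟩ : Fin d), |Real.sinc (Real.pi * (x j + y))| ≤ 1 :=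
    Finset.prod_le_one (fun _ _ => abs_nonneg _) fun _ _ => Real.abs_sinc_le_one _
  set a := |Real.sinc (Real.pi * y)| with ha
  set b := |Real.sinc (Real.pi * (x ⟨0, hd⟩ + y))| with hb
  have ha0 : 0 ≤ a := abs_nonneg _
  have hb0 : 0 ≤ b := abs_nonneg _
  rw [← sq_abs (Real.sinc (Real.pi * y)), ← sq_abs (Real.sinc (Real.pi * (x ⟨0, hd⟩ + y))),
    ← ha, ← hb]
  calc _ ≤ a * (b * 1) := by gcongr
    _ ≤ _ := by nlinarith [sq_nonneg (a - b)]

open FourierTransform in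
/-- The modulus of `h_{1,∞}(0, x)` is that of the Fourier transform of the solid simplex. -/
theorem norm_hInfty_cons_zero (hd : 0 < d) :
    ‖hInfty 1 (Fin.cons 0 x : Fin (d + 1) → ℝ)‖ = ‖simplexFourier d x‖ := by
  have h := (integrable_slabIntegral x).fourierInv_fourier_eq
    (integrable_fourier_slabIntegral x hd) (continuousAt_slabIntegral x hd)
  rw [slabIntegral_zero, Real.fourierInv_eq'] at h
  simp only [inner_zero_right, mul_zero, Complex.ofReal_zero, zero_mul, Complex.exp_zero,
    one_smul] at h
  have e : ∀ y : ℝ, 𝓕 (slabIntegral x) y = phase (∑ j, x j / 2) *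
      (Complex.exp (Complex.I * (Real.pi * 1 * (((d + 1 : ℕ) : ℝ) - 2) * y : ℝ)) *
      ((∏ j, Real.sinc (Real.pi * 1 * (y + (Fin.cons 0 x : Fin (d + 1) → ℝ) j)) : ℝ) : ℂ)) := by
    intro y
    rw [fourier_slabIntegral, Fin.prod_univ_succ, Finset.prod_mul_distrib, ← phase_sum]
    have e1 : Complex.exp (Complex.I * (Real.pi * 1 * (((d + 1 : ℕ) : ℝ) - 2) * y : ℝ)) =
        phase (((d : ℝ) - 1) * y / 2) := by
      rw [phase]
      congr 1
      push_cast
      ring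
    -- The half-phases of the `d + 1` factors combine to `(d - 1) y / 2`, the exponential in
    -- `hInfty` for `n = d + 1`, times a constant of modulus one.
    have e2 : phase (∑ j, (x j + y) / 2) * phase (-y / 2) =
        phase (∑ j, x j / 2) * phase (((d : ℝ) - 1) * y / 2) := by
      rw [← phase_add, ← phase_add]
      congr 1
      simp only [add_div, Finset.sum_add_distrib, Finset.sum_const, Finset.card_univ,
        Fintype.card_fin, nsmul_eq_mul]
      ring
    rw [e1]
    simp only [Fin.cons_zero, Fin.cons_succ, mul_one, add_comm y, zero_add, mul_neg, Real.sinc_neg,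
      Complex.ofReal_mul, Complex.ofReal_prod]
    linear_combination ((Real.sinc (Real.pi * y) : ℝ) : ℂ) *
      (∏ j, ((Real.sinc (Real.pi * (x j + y)) : ℝ) : ℂ)) * e2
  simp_rw [e] at h
  rw [integral_const_mul] at h
  rw [← h, norm_mul, norm_phase, one_mul, hInfty]
  simp

end SincIntegral


/-! ### Lattice points as coefficients, and their asymptotics -/

section Counting

open MvPolynomial

/-- The exponents of total degree at most `t`. -/
def exponentsLE (k t : ℕ) : Finset (Fin k →₀ ℕ) :=
  (Finset.range (t + 1)).biUnion fun n => (Finset.univ : Finset (Fin k)).finsuppAntidiag n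

theorem mem_exponentsLE {k t : ℕ} {a : Fin k →₀ ℕ} : a ∈ exponentsLE k t ↔ ∑ j, a j ≤ t := by
  simp only [exponentsLE, Finset.mem_biUnion, Finset.mem_range, Finset.mem_finsuppAntidiag,
    Finset.subset_univ, and_true, Nat.lt_succ_iff]
  constructor
  · rintro ⟨n, hn, rfl⟩
    exact hn
  · intro h
    exact ⟨_, h, rfl⟩

theorem completeHomogLE_eq_sum (k t : ℕ) :
    completeHomogLE k t = ∑ a ∈ exponentsLE k t, monomial a 1 := by
  rw [exponentsLE, Finset.sum_biUnion]
  · rfl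
  · intro m _ n _ hmn
    rw [Function.onFun, Finset.disjoint_left]
    intro a ha hb
    rw [Finset.mem_finsuppAntidiag] at ha hb
    exact hmn (ha.1.symm.trans hb.1)

theorem coeff_sum_monomial_pow {k : ℕ} (S : Finset (Fin k →₀ ℕ)) (c : Fin k →₀ ℕ) :
    coeff c ((∑ a ∈ S, monomial a (1 : ℤ)) ^ k) =
      ((Fintype.piFinset fun _ : Fin k => S).filter fun B => ∑ i, B i = c).card := by
  classical
  have h := Finset.prod_univ_sum (fun _ : Fin k => S)
    (fun _ a => (monomial a (1 : ℤ) : MvPolynomial (Fin k) ℤ))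
  rw [Finset.prod_const, Finset.card_univ, Fintype.card_fin] at h
  rw [h, coeff_sum]
  simp only [prod_monomial, coeff_monomial]
  rw [Finset.sum_boole]

/-- A family of exponent vectors as an integer matrix. -/
def exponentMatrix {k : ℕ} (B : Fin k → Fin k →₀ ℕ) (p : Fin k × Fin k) : ℤ := B p.1 p.2

theorem exponentMatrix_injective (k : ℕ) :
    Function.Injective (exponentMatrix : (Fin k → Fin k →₀ ℕ) → Fin k × Fin k → ℤ) := by
  intro B C h
  ext i j
  exact Int.ofNat_injective (congrFun h (i, j))

theorem exponentMatrix_row_sum {k : ℕ} (B : Fin k → Fin k →₀ ℕ) (i : Fin k) :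
    ∑ j, exponentMatrix B (i, j) = ((∑ j, B i j : ℕ) : ℤ) := by simp [exponentMatrix]

theorem exponentMatrix_col_sum {k : ℕ} (B : Fin k → Fin k →₀ ℕ) (j : Fin k) :
    ∑ i, exponentMatrix B (i, j) = ((∑ i, B i j : ℕ) : ℤ) := by simp [exponentMatrix]

theorem exists_exponentMatrix_eq {k : ℕ} {A : Fin k × Fin k → ℤ} (hA : ∀ i j, 0 ≤ A (i, j)) :
    ∃ B, exponentMatrix B = A :=
  ⟨fun i => Finsupp.equivFunOnFinite.symm fun j => (A (i, j)).toNat, by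
    ext ⟨i, j⟩
    simp [exponentMatrix, hA i j]⟩

theorem mem_smul_subBirkhoff_iff {k t : ℕ} (ht : 0 < t) (A : Fin k × Fin k → ℤ) :
    WithLp.toLp 2 (fun p => (A p : ℝ)) ∈ (t : ℝ) • subBirkhoffPolytope k ↔
      (∀ i j, 0 ≤ A (i, j)) ∧ (∀ i, ∑ j, A (i, j) ≤ t) ∧ ∀ j, ∑ i, A (i, j) ≤ t := by
  have ht' : (0 : ℝ) < t := by positivity
  rw [Set.mem_smul_set_iff_inv_smul_mem₀ ht'.ne']
  simp only [subBirkhoffPolytope, Set.mem_ofPred_eq, PiLp.smul_apply, smul_eq_mul,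
    ← Finset.mul_sum, inv_mul_le_iff₀ ht', mul_one, mul_nonneg_iff_of_pos_left (inv_pos.mpr ht')]
  norm_cast

theorem mem_smul_birkhoff_iff {k t : ℕ} (ht : 0 < t) (A : Fin k × Fin k → ℤ) :
    WithLp.toLp 2 (fun p => (A p : ℝ)) ∈ (t : ℝ) • birkhoffPolytope k ↔
      (∀ i j, 0 ≤ A (i, j)) ∧ (∀ i, ∑ j, A (i, j) = t) ∧ ∀ j, ∑ i, A (i, j) = t := by
  have ht' : (0 : ℝ) < t := by positivity
  rw [Set.mem_smul_set_iff_inv_smul_mem₀ ht'.ne']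
  simp only [birkhoffPolytope, Set.mem_ofPred_eq, PiLp.smul_apply, smul_eq_mul,
    ← Finset.mul_sum, inv_mul_eq_iff_eq_mul₀ ht'.ne', mul_one,
    mul_nonneg_iff_of_pos_left (inv_pos.mpr ht')]
  norm_cast

/-- The `i`-th factor of `H_t ^ k` supplies row `i`, of sum at most `t`; the exponent of the product
is the vector of column sums. -/
theorem ehrhart_subBirkhoff {k t : ℕ} (ht : 0 < t) :
    (ehrhart t (subBirkhoffPolytope k) : ℤ) = boxCoeffSum t (completeHomogLE k t ^ k) := by
  classical
  have h1 : boxCoeffSum t (completeHomogLE k t ^ k) =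
      ((Fintype.piFinset fun _ : Fin k => exponentsLE k t).filter
        fun B => ∀ j, ∑ i, B i j ≤ t).card := by
    rw [boxCoeffSum, completeHomogLE_eq_sum]
    simp_rw [coeff_sum_monomial_pow]
    rw [← Nat.cast_sum, Finset.card_eq_sum_card_fiberwise
      (f := fun B : Fin k → Fin k →₀ ℕ => fun j => ∑ i, B i j)
      (t := Fintype.piFinset fun _ : Fin k => Finset.range (t + 1))]
    · congr 1
      refine Finset.sum_congr rfl fun c hc => ?_
      congr 1
      ext B
      simp only [Finset.mem_filter, and_assoc]
      refine and_congr_right fun _ => ?_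
      rw [Fintype.mem_piFinset] at hc
      constructor
      · intro h
        have h2 : ∀ j, ∑ i, B i j = c j := fun j => by
          have := DFunLike.congr_fun h j
          simpa [Finsupp.finsetSum_apply] using this
        refine ⟨fun j => ?_, funext h2⟩
        rw [h2]
        exact Nat.lt_succ_iff.mp (Finset.mem_range.mp (hc j))
      · rintro ⟨-, h⟩
        ext j
        rw [Finsupp.finsetSum_apply]
        exact congrFun h j
    · intro B hB
      simp only [Finset.coe_filter, Set.mem_ofPred_eq] at hB
      simp only [Finset.mem_coe, Fintype.mem_piFinset, Finset.mem_range, Nat.lt_succ_iff]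
      exact hB.2
  rw [h1, ehrhart, ← Set.ncard_coe_finset,
    ← Set.ncard_image_of_injective _ (exponentMatrix_injective k)]
  congr 2
  ext A
  rw [Set.mem_ofPred_eq, mem_smul_subBirkhoff_iff ht]
  simp only [Finset.coe_filter, Set.mem_image, Set.mem_ofPred_eq, Fintype.mem_piFinset,
    mem_exponentsLE]
  constructor
  · rintro ⟨h0, hr, hc⟩
    obtain ⟨B, rfl⟩ := exists_exponentMatrix_eq h0
    simp only [exponentMatrix_row_sum, exponentMatrix_col_sum] at hr hc
    exact ⟨B, ⟨fun i => by exact_mod_cast hr i, fun j => by exact_mod_cast hc j⟩, rfl⟩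
  · rintro ⟨B, ⟨hr, hc⟩, rfl⟩
    exact ⟨fun i j => by simp [exponentMatrix],
      fun i => by rw [exponentMatrix_row_sum]; exact_mod_cast hr i,
      fun j => by rw [exponentMatrix_col_sum]; exact_mod_cast hc j⟩

theorem ehrhart_birkhoff {k t : ℕ} (ht : 0 < t) :
    (ehrhart t (birkhoffPolytope k) : ℤ) = magicCoeff k t := by
  classical
  rw [magicCoeff, completeHomog, coeff_sum_monomial_pow, ehrhart, ← Set.ncard_coe_finset,
    ← Set.ncard_image_of_injective _ (exponentMatrix_injective k)]
  congr 2
  ext A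
  rw [Set.mem_ofPred_eq, mem_smul_birkhoff_iff ht]
  simp only [Finset.coe_filter, Set.mem_image, Set.mem_ofPred_eq, Fintype.mem_piFinset,
    Finset.mem_finsuppAntidiag, Finset.subset_univ, and_true]
  constructor
  · rintro ⟨h0, hr, hc⟩
    obtain ⟨B, rfl⟩ := exists_exponentMatrix_eq h0
    simp only [exponentMatrix_row_sum, exponentMatrix_col_sum] at hr hc
    refine ⟨B, ⟨fun i => by exact_mod_cast hr i, ?_⟩, rfl⟩
    ext j
    rw [Finsupp.finsetSum_apply]
    exact_mod_cast hc j
  · rintro ⟨B, ⟨hr, hc⟩, rfl⟩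
    refine ⟨fun i j => by simp [exponentMatrix],
      fun i => by rw [exponentMatrix_row_sum]; exact_mod_cast hr i, fun j => ?_⟩
    have := DFunLike.congr_fun hc j
    rw [Finsupp.finsetSum_apply] at this
    rw [exponentMatrix_col_sum, this]
    rfl

end Counting

theorem card_inter_inv_smul_span {ι : Type*} [Fintype ι] (s : Set (ι → ℝ)) {t : ℕ} (ht : 0 < t) :
    Nat.card ↑(s ∩ (t : ℝ)⁻¹ • (Submodule.span ℤ (Set.range (Pi.basisFun ℝ ι)) : Set (ι → ℝ))) =
      Set.ncard {A : ι → ℤ | (fun i => (t : ℝ)⁻¹ * (A i : ℝ)) ∈ s} := by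
  have ht' : (t : ℝ)⁻¹ ≠ 0 := by positivity
  have hinj : Function.Injective fun (A : ι → ℤ) (i : ι) => (t : ℝ)⁻¹ * (A i : ℝ) := by
    intro A B h
    ext i
    have := mul_left_cancel₀ ht' (congrFun h i)
    exact_mod_cast this
  rw [Nat.card_coe_set_eq, ← Set.ncard_image_of_injective _ hinj]
  congr 1
  ext v
  rw [Set.mem_inter_iff, mem_inv_smul_span_iff ht]
  constructor
  · rintro ⟨hv, A, rfl⟩
    exact ⟨A, hv, rfl⟩
  · rintro ⟨A, hA, rfl⟩
    exact ⟨hA, A, rfl⟩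

/-- Lattice points in dilates of a compact convex set count its volume. -/
theorem tendsto_ncard_div_pow {ι : Type*} [Fintype ι] {s : Set (ι → ℝ)}
    (hb : Bornology.IsBounded s) (hcl : IsClosed s) (hc : Convex ℝ s) :
    Tendsto (fun t : ℕ => (Set.ncard {A : ι → ℤ | (fun i => (t : ℝ)⁻¹ * (A i : ℝ)) ∈ s} : ℝ) /
      (t : ℝ) ^ Fintype.card ι) atTop (𝓝 (volume.real s)) := by
  refine (tendsto_card_div_pow_atTop_volume s hb hcl.measurableSet
    (hc.addHaar_frontier _)).congr' ?_
  filter_upwards [eventually_gt_atTop 0] with t ht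
  rw [card_inter_inv_smul_span s ht]

/-- The row sums of a square array. -/
def rowSums (k : ℕ) : (Fin k × Fin k → ℝ) →ₗ[ℝ] Fin k → ℝ :=
  LinearMap.pi fun i => ∑ j, LinearMap.proj (i, j)

/-- The column sums of a square array. -/
def colSums (k : ℕ) : (Fin k × Fin k → ℝ) →ₗ[ℝ] Fin k → ℝ :=
  LinearMap.pi fun j => ∑ i, LinearMap.proj (i, j)

theorem tendsto_ehrhart_subBirkhoff (k : ℕ) :
    Tendsto (fun t : ℕ => (ehrhart t (subBirkhoffPolytope k) : ℝ) / (t : ℝ) ^ (k ^ 2)) atTop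
      (𝓝 (volSubBirkhoff k)) := by
  let s : Set (Fin k × Fin k → ℝ) := WithLp.toLp 2 ⁻¹' subBirkhoffPolytope k
  have hs : s = (Set.Ici 0 ∩ rowSums k ⁻¹' Set.Iic 1) ∩ colSums k ⁻¹' Set.Iic 1 := by
    ext M
    simp [s, subBirkhoffPolytope, rowSums, colSums, Pi.le_def, and_assoc]
  have hcl : IsClosed s := by
    rw [hs]
    exact (isClosed_Ici.inter (isClosed_Iic.preimage (LinearMap.continuous_of_finiteDimensional _))
      ).inter (isClosed_Iic.preimage (LinearMap.continuous_of_finiteDimensional _))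
  have hc : Convex ℝ s := by
    rw [hs]
    exact ((convex_Ici _).inter ((convex_Iic _).linear_preimage _)).inter
      ((convex_Iic _).linear_preimage _)
  have hb : Bornology.IsBounded s := by
    refine (Metric.isBounded_Icc (0 : Fin k × Fin k → ℝ) 1).subset fun M hM => ?_
    exact ⟨fun p => hM.1 p.1 p.2, fun p => (Finset.single_le_sum
      (f := fun j => M (p.1, j)) (fun j _ => hM.1 p.1 j) (Finset.mem_univ p.2)).trans
        (hM.2.1 p.1)⟩
  have h := tendsto_ncard_div_pow hb hcl hc
  have hv : volume.real s = volSubBirkhoff k := by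
    rw [volSubBirkhoff, measureReal_def]
    congr 1
    exact (PiLp.volume_preserving_toLp (Fin k × Fin k)).measure_preimage_emb
      (MeasurableEquiv.toLp 2 _).measurableEmbedding _
  rw [hv, Fintype.card_prod, Fintype.card_fin, ← sq] at h
  refine h.congr' ?_
  filter_upwards [eventually_gt_atTop 0] with t ht
  rw [ehrhart]
  congr 2
  congr 1
  ext A
  rw [Set.mem_ofPred_eq, Set.mem_ofPred_eq, Set.mem_smul_set_iff_inv_smul_mem₀ (by positivity)]
  rfl


/-! ### Volume of affine images by Gram determinants -/

section GramVolume

open Matrix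

variable {m n : Type*} [Fintype m] [Fintype n] [DecidableEq n]

/-- A matrix with independent columns factors through an orthonormal system. -/
theorem exists_orthonormal_factorization (X : Matrix m n ℝ) (hX : (Xᵀ * X).det ≠ 0) :
    ∃ (U : Matrix m n ℝ) (G : Matrix n n ℝ), Uᵀ * U = 1 ∧ X = U * G := by
  classical
  have hli : LinearIndependent ℝ fun j => (WithLp.toLp 2 (X.col j) : EuclideanSpace ℝ m) := by
    rw [Fintype.linearIndependent_iff]
    intro g hg
    have h1 : X *ᵥ g = 0 := by
      ext i
      have := congrArg (fun v : EuclideanSpace ℝ m => v i) hg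
      simpa [mulVec, dotProduct, mul_comm] using this
    have h2 : (Xᵀ * X) *ᵥ g = 0 := by rw [← mulVec_mulVec, h1, mulVec_zero]
    exact congrFun (eq_zero_of_mulVec_eq_zero hX h2)
  set V := Submodule.span ℝ (Set.range fun j => (WithLp.toLp 2 (X.col j) : EuclideanSpace ℝ m))
  have hV : Module.finrank ℝ V = Fintype.card n := finrank_span_eq_card hli
  obtain ⟨b⟩ : Nonempty (OrthonormalBasis n ℝ V) := ⟨(stdOrthonormalBasis ℝ V).reindex
    ((finCongr hV).trans (Fintype.equivFin n).symm)⟩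
  let x : n → V := fun j => ⟨_, Submodule.subset_span ⟨j, rfl⟩⟩
  refine ⟨of fun i j => (b j : EuclideanSpace ℝ m) i, of fun j l => b.repr (x l) j, ?_, ?_⟩
  · ext j l
    have h := (orthonormal_iff_ite.mp b.orthonormal) j l
    rw [Submodule.coe_inner, PiLp.inner_apply] at h
    simp only [mul_apply, transpose_apply, of_apply, one_apply]
    rw [← h]
    exact Finset.sum_congr rfl fun i _ => mul_comm _ _
  · ext i l
    have h := congrArg (fun v : V => (v : EuclideanSpace ℝ m) i) (b.sum_repr (x l))
    rw [Submodule.coe_sum] at h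
    simp only [mul_apply, of_apply]
    have h3 : (x l : EuclideanSpace ℝ m) i = X i l := rfl
    rw [← h3, ← h, WithLp.ofLp_sum, Finset.sum_apply]
    exact Finset.sum_congr rfl fun j _ => mul_comm _ _

/-- Write `X = U G` with orthonormal columns in `U`. Then `U` is an isometry, which preserves the
measure, and `G` is square with `|det G| = √det (Xᵀ X)`. -/
theorem euclideanHausdorffMeasure_affine_image (X : Matrix m n ℝ) (hX : (Xᵀ * X).det ≠ 0)
    (c : EuclideanSpace ℝ m) (s : Set (n → ℝ)) :
    (Measure.euclideanHausdorffMeasure (Fintype.card n) : Measure (EuclideanSpace ℝ m))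
      ((fun x => c + WithLp.toLp 2 (X *ᵥ x)) '' s) =
      ENNReal.ofReal √(Xᵀ * X).det * volume s := by
  obtain ⟨U, G, hU, rfl⟩ := exists_orthonormal_factorization X hX
  have hdet : √((U * G)ᵀ * (U * G)).det = |G.det| := by
    rw [transpose_mul, Matrix.mul_assoc, ← Matrix.mul_assoc Uᵀ, hU, Matrix.one_mul, det_mul,
      det_transpose, ← sq, Real.sqrt_sq_eq_abs]
  have hiso : Isometry fun v : EuclideanSpace ℝ n =>
      c + (WithLp.toLp 2 (U *ᵥ v.ofLp) : EuclideanSpace ℝ m) := by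
    refine (isometry_add_left c).comp ?_
    refine Isometry.of_dist_eq fun v w => ?_
    rw [dist_eq_norm, dist_eq_norm, ← WithLp.toLp_sub, ← mulVec_sub, ← WithLp.ofLp_sub]
    generalize v - w = z
    rw [← sq_eq_sq₀ (norm_nonneg _) (norm_nonneg _), EuclideanSpace.real_norm_sq_eq,
      EuclideanSpace.real_norm_sq_eq]
    have h : (U *ᵥ z.ofLp) ⬝ᵥ (U *ᵥ z.ofLp) = z.ofLp ⬝ᵥ z.ofLp := by
      rw [dotProduct_mulVec, vecMul_mulVec, hU, vecMul_one]
    simpa [dotProduct, sq] using h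
  have himg : (fun x => c + WithLp.toLp 2 ((U * G) *ᵥ x)) '' s =
      (fun v : EuclideanSpace ℝ n => c + (WithLp.toLp 2 (U *ᵥ v.ofLp) : EuclideanSpace ℝ m)) ''
        (WithLp.toLp 2 '' (toLin' G '' s)) := by
    simp only [Set.image_image, toLin'_apply, mulVec_mulVec]
  have hfin : Fintype.card n = Module.finrank ℝ (EuclideanSpace ℝ n) := finrank_euclideanSpace.symm
  rw [himg, hiso.euclideanHausdorffMeasure_image, hfin,
    InnerProductSpace.euclideanHausdorffMeasure_eq_volume, hdet, ← LinearMap.det_toLin',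
    ← Measure.addHaar_image_linearMap,
    ← (PiLp.volume_preserving_toLp n).measure_preimage_emb
      (MeasurableEquiv.toLp 2 _).measurableEmbedding,
    Set.preimage_image_eq _ (WithLp.toLp_injective 2)]

end GramVolume


/-! ### Bordering a matrix to prescribed line sums -/

section Border

variable {R : Type*} [CommRing R] {d : ℕ}

/-- Border a `d × d` array by a first row and a first column so that all line sums are `c`. -/
def border (c : R) (N : Fin d × Fin d → R) (p : Fin (d + 1) × Fin (d + 1)) : R :=
  Fin.cases
    (Fin.cases (c - ∑ j, (c - ∑ i, N (i, j))) (fun j => c - ∑ i, N (i, j)) p.2)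
    (fun i => Fin.cases (c - ∑ j, N (i, j)) (fun j => N (i, j)) p.2) p.1

@[simp]
theorem border_succ_succ (c : R) (N : Fin d × Fin d → R) (i j : Fin d) :
    border c N (i.succ, j.succ) = N (i, j) := rfl

@[simp]
theorem border_succ_zero (c : R) (N : Fin d × Fin d → R) (i : Fin d) :
    border c N (i.succ, 0) = c - ∑ j, N (i, j) := rfl

@[simp]
theorem border_zero_succ (c : R) (N : Fin d × Fin d → R) (j : Fin d) :
    border c N (0, j.succ) = c - ∑ i, N (i, j) := rfl

@[simp]
theorem border_zero_zero (c : R) (N : Fin d × Fin d → R) :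
    border c N (0, 0) = c - ∑ j, (c - ∑ i, N (i, j)) := rfl

theorem border_row_sum (c : R) (N : Fin d × Fin d → R) (i : Fin (d + 1)) :
    ∑ j, border c N (i, j) = c := by
  rw [Fin.sum_univ_succ]
  cases i using Fin.cases <;> simp

theorem border_col_sum (c : R) (N : Fin d × Fin d → R) (j : Fin (d + 1)) :
    ∑ i, border c N (i, j) = c := by
  rw [Fin.sum_univ_succ]
  cases j using Fin.cases with
  | zero =>
    simp only [border_zero_zero, border_succ_zero, Finset.sum_sub_distrib]
    rw [Finset.sum_comm]
    ring
  | succ j => simp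

theorem border_restrict {c : R} {M : Fin (d + 1) × Fin (d + 1) → R}
    (hr : ∀ i, ∑ j, M (i, j) = c) (hc : ∀ j, ∑ i, M (i, j) = c) :
    border c (fun p => M (p.1.succ, p.2.succ)) = M := by
  have hr' : ∀ i, M (i, 0) = c - ∑ j : Fin d, M (i, j.succ) := fun i => by
    rw [← hr i, Fin.sum_univ_succ]
    ring
  have hc' : ∀ j, M (0, j) = c - ∑ i : Fin d, M (i.succ, j) := fun j => by
    rw [← hc j, Fin.sum_univ_succ]
    ring
  ext ⟨i, j⟩
  cases i using Fin.cases with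
  | zero =>
    cases j using Fin.cases with
    | zero => rw [border_zero_zero, hr']; simp only [hc']
    | succ j => rw [border_zero_succ, hc']
  | succ i =>
    cases j using Fin.cases with
    | zero => rw [border_succ_zero, hr']
    | succ j => rfl

theorem border_injective (c : R) : Function.Injective (border (d := d) c) := by
  intro M N h
  ext ⟨i, j⟩
  exact congrFun h (i.succ, j.succ)

theorem border_map {S : Type*} [CommRing S] (f : R →+* S) (c : R) (N : Fin d × Fin d → R)
    (p : Fin (d + 1) × Fin (d + 1)) :
    f (border c N p) = border (f c) (fun q => f (N q)) p := by
  obtain ⟨i, j⟩ := p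
  cases i using Fin.cases <;> cases j using Fin.cases <;> simp

theorem mul_border (a c : R) (N : Fin d × Fin d → R) (p : Fin (d + 1) × Fin (d + 1)) :
    a * border c N p = border (a * c) (fun q => a * N q) p := by
  obtain ⟨i, j⟩ := p
  cases i using Fin.cases <;> cases j using Fin.cases <;>
    simp [mul_sub, Finset.mul_sum, mul_left_comm]

open Matrix Kronecker

/-- The matrix adding to a vector a first entry that makes its sum zero. -/
def zeroSumMatrix (d : ℕ) (R : Type*) [CommRing R] : Matrix (Fin (d + 1)) (Fin d) R :=
  of fun i j => Fin.cases (-1) (fun i' => (1 : Matrix (Fin d) (Fin d) R) i' j) i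

theorem border_eq_add_mulVec (c : R) (N : Fin d × Fin d → R) :
    border c N = border c 0 + (zeroSumMatrix d R ⊗ₖ zeroSumMatrix d R) *ᵥ N := by
  ext ⟨i, j⟩
  rw [Pi.add_apply, mulVec, dotProduct, Fintype.sum_prod_type]
  cases i using Fin.cases <;> cases j using Fin.cases <;>
    simp [zeroSumMatrix, one_apply, Finset.sum_sub_distrib]
  · rw [Finset.sum_comm]; ring
  · ring
  · ring

/-- The Gram matrix is the identity plus the all-ones matrix, a perturbation of rank at most one. -/
theorem det_zeroSumMatrix_gram (d : ℕ) :
    ((zeroSumMatrix d R)ᵀ * zeroSumMatrix d R).det = d + 1 := by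
  have h : (zeroSumMatrix d R)ᵀ * zeroSumMatrix d R =
      1 + replicateCol Unit (fun _ => (1 : R)) * replicateRow Unit (fun _ => (1 : R)) := by
    ext i j
    rw [mul_apply, Fin.sum_univ_succ]
    simp [zeroSumMatrix, mul_apply, one_apply, add_comm, eq_comm]
  rw [h, det_one_add_replicateCol_mul_replicateRow]
  simp [dotProduct, add_comm]

theorem det_kronecker_zeroSumMatrix_gram (d : ℕ) :
    ((zeroSumMatrix d R ⊗ₖ zeroSumMatrix d R)ᵀ * (zeroSumMatrix d R ⊗ₖ zeroSumMatrix d R)).det =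
      ((d + 1) ^ d) ^ 2 := by
  rw [← kroneckerMap_transpose, ← mul_kronecker_mul, det_kronecker, det_zeroSumMatrix_gram,
    Fintype.card_fin, sq]

end Border

/-! ### Volume and lattice points of the Birkhoff polytope -/

section BirkhoffVolume

open Matrix Kronecker

/-- The Birkhoff polytope in the coordinates given by all rows and columns but the first. -/
def birkhoffChart (d : ℕ) : Set (Fin d × Fin d → ℝ) := {N | ∀ p, 0 ≤ border 1 N p}

theorem birkhoffPolytope_eq_image (d : ℕ) :
    birkhoffPolytope (d + 1) = (fun N => WithLp.toLp 2 (border 1 N)) '' birkhoffChart d := by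
  ext M
  constructor
  · rintro ⟨h0, hr, hc⟩
    refine ⟨fun p => M (p.1.succ, p.2.succ), fun p => ?_, ?_⟩
    · rw [border_restrict (M := M.ofLp) hr hc]
      exact h0 p.1 p.2
    · simp only
      rw [border_restrict (M := M.ofLp) hr hc]
  · rintro ⟨N, hN, rfl⟩
    exact ⟨fun i j => hN (i, j), border_row_sum 1 N, border_col_sum 1 N⟩

theorem birkhoffChart_eq_preimage (d : ℕ) :
    birkhoffChart d = toLin' (zeroSumMatrix d ℝ ⊗ₖ zeroSumMatrix d ℝ) ⁻¹' Set.Ici (-border 1 0) := by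
  ext N
  rw [Set.mem_preimage, Set.mem_Ici, toLin'_apply, neg_le_iff_add_nonneg', ← border_eq_add_mulVec]
  rfl

theorem isClosed_birkhoffChart (d : ℕ) : IsClosed (birkhoffChart d) := by
  rw [birkhoffChart_eq_preimage]
  exact isClosed_Ici.preimage (LinearMap.continuous_of_finiteDimensional _)

theorem convex_birkhoffChart (d : ℕ) : Convex ℝ (birkhoffChart d) := by
  rw [birkhoffChart_eq_preimage]
  exact (convex_Ici _).linear_preimage _

theorem isBounded_birkhoffChart (d : ℕ) : Bornology.IsBounded (birkhoffChart d) := by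
  refine (Metric.isBounded_Icc (0 : Fin d × Fin d → ℝ) 1).subset fun N hN => ?_
  refine ⟨fun p => hN (p.1.succ, p.2.succ), fun p => ?_⟩
  have h := Finset.single_le_sum (f := fun j => border 1 N (p.1.succ, j))
    (fun j _ => hN (p.1.succ, j)) (Finset.mem_univ p.2.succ)
  exact h.trans (border_row_sum 1 N _).le

/-- Bordering is affine with linear part `Z ⊗ Z` for `Z = zeroSumMatrix d ℝ`. Its Gram determinant
is `((d + 1) ^ d) ^ 2`, which is the source of the factor `k ^ (k - 1)`. -/
theorem volBirkhoff_succ (d : ℕ) :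
    volBirkhoff (d + 1) = ((d : ℝ) + 1) ^ d * volume.real (birkhoffChart d) := by
  have h := euclideanHausdorffMeasure_affine_image (zeroSumMatrix d ℝ ⊗ₖ zeroSumMatrix d ℝ)
    (by rw [det_kronecker_zeroSumMatrix_gram]; positivity) (WithLp.toLp 2 (border 1 0))
    (birkhoffChart d)
  rw [det_kronecker_zeroSumMatrix_gram, Real.sqrt_sq (by positivity)] at h
  simp only [← WithLp.toLp_add, ← border_eq_add_mulVec] at h
  rw [← birkhoffPolytope_eq_image, Fintype.card_prod, Fintype.card_fin, ← sq] at h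
  rw [volBirkhoff, Nat.add_sub_cancel, h, ENNReal.toReal_mul, measureReal_def,
    ENNReal.toReal_ofReal (by positivity)]

/-- Bordering and restriction both preserve integrality, so no index factor appears and the counts
see the volume of the chart, not the Euclidean volume of the polytope. -/
theorem ehrhart_birkhoff_succ {d t : ℕ} (ht : 0 < t) :
    ehrhart t (birkhoffPolytope (d + 1)) =
      Set.ncard {A : Fin d × Fin d → ℤ | (fun i => (t : ℝ)⁻¹ * (A i : ℝ)) ∈ birkhoffChart d} := by
  have ht' : (0 : ℝ) < t := by positivity
  have hmem : ∀ A : Fin d × Fin d → ℤ, (fun i => (t : ℝ)⁻¹ * (A i : ℝ)) ∈ birkhoffChart d ↔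
      ∀ p, 0 ≤ border (t : ℤ) A p := by
    intro A
    refine forall_congr' fun p => ?_
    have h := mul_border (t : ℝ)⁻¹ t (fun q => (A q : ℝ)) p
    have h2 := border_map (Int.castRingHom ℝ) (t : ℤ) A p
    simp only [eq_intCast, Int.cast_natCast] at h2
    rw [inv_mul_cancel₀ ht'.ne', ← h2] at h
    rw [← h, mul_nonneg_iff_of_pos_left (inv_pos.mpr ht'), Int.cast_nonneg_iff]
  rw [← Set.ncard_image_of_injective {A : Fin d × Fin d → ℤ | _} (border_injective (t : ℤ))]
  refine congrArg Set.ncard (Set.ext fun A => ?_)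
  rw [Set.mem_ofPred_eq, mem_smul_birkhoff_iff ht]
  simp only [hmem]
  constructor
  · rintro ⟨h0, hr, hc⟩
    have h := border_restrict hr hc
    exact ⟨_, fun p => by rw [h]; exact h0 p.1 p.2, h⟩
  · rintro ⟨N, hN, rfl⟩
    exact ⟨fun i j => hN (i, j), border_row_sum _ N, border_col_sum _ N⟩

theorem tendsto_ehrhart_birkhoff_succ (d : ℕ) :
    Tendsto (fun t : ℕ => (ehrhart t (birkhoffPolytope (d + 1)) : ℝ) / (t : ℝ) ^ (d ^ 2)) atTop
      (𝓝 (volBirkhoff (d + 1) / ((d : ℝ) + 1) ^ d)) := by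
  have h := tendsto_ncard_div_pow (isBounded_birkhoffChart d) (isClosed_birkhoffChart d)
    (convex_birkhoffChart d)
  rw [volBirkhoff_succ, mul_div_cancel_left₀ _ (by positivity)]
  rw [Fintype.card_prod, Fintype.card_fin, ← sq] at h
  refine h.congr' ?_
  filter_upwards [eventually_gt_atTop 0] with t ht
  rw [ehrhart_birkhoff_succ ht]

end BirkhoffVolume


/-! ### The rescaled Vandermonde determinant -/

section Vandermonde

variable {k : ℕ}

theorem norm_phase_sub (a b : ℝ) :
    ‖phase a - phase b‖ = 2 * Real.pi * |b - a| * |Real.sinc (Real.pi * (b - a))| := by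
  have h : phase a - phase b = phase a * (1 - phase (b - a)) := by
    rw [mul_sub, mul_one, ← phase_add, add_sub_cancel]
  rw [h, norm_mul, norm_phase, one_mul, norm_sub_rev, phase, mul_comm _ Complex.I,
    Complex.norm_exp_I_mul_ofReal_sub_one, mul_assoc 2 Real.pi, mul_div_cancel_left₀ _ two_ne_zero]
  rcases eq_or_ne (b - a) 0 with h0 | h0
  · simp [h0]
  · have h1 : Real.pi * (b - a) ≠ 0 := mul_ne_zero Real.pi_ne_zero h0
    rw [Real.sinc_of_ne_zero h1, norm_mul, Real.norm_eq_abs, Real.norm_eq_abs, abs_div, abs_mul,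
      abs_two, abs_of_pos Real.pi_pos]
    have : |b - a| ≠ 0 := abs_ne_zero.mpr h0
    field_simp

theorem evalPhase_vandermondePoly (φ : Fin k → ℝ) :
    evalPhase (vandermondePoly k) φ =
      ∏ i, ∏ j ∈ Finset.Ioi i, (phase (φ j) - phase (φ i)) := by
  rw [← Matrix.det_vandermonde, ← Matrix.det_transpose, evalPhase, vandermondePoly, AlgHom.map_det]
  congr 1
  ext i j
  simp

theorem two_mul_sum_card_Ioi (k : ℕ) :
    2 * ∑ i : Fin k, (Finset.Ioi i).card = k * (k - 1) := by
  simp only [Fin.card_Ioi]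
  rw [Fin.sum_univ_eq_sum_range (fun i => k - 1 - i), Finset.sum_range_reflect (fun i => i),
    mul_comm, Finset.sum_range_id_mul_two]

theorem prod_prod_Ioi_const (c : ℝ) :
    ∏ i : Fin k, ∏ _j ∈ Finset.Ioi i, c = c ^ (k * (k - 1) / 2) := by
  simp only [Finset.prod_const, Finset.prod_pow_eq_pow_sum]
  rw [← two_mul_sum_card_Ioi, Nat.mul_div_cancel_left _ two_pos]

/-- The scale comes out exactly, leaving sinc factors that tend to `1` as `s → 0` and never exceed
`1` in modulus: one formula serves both the pointwise limit and the uniform bound. -/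
theorem norm_evalPhase_vandermondePoly_smul (φ : Fin k → ℝ) {s : ℝ} (hs : 0 ≤ s) :
    ‖evalPhase (vandermondePoly k) (s • φ)‖ =
      s ^ (k * (k - 1) / 2) * ((2 * Real.pi) ^ (k * (k - 1) / 2) * |vandermondeProd φ| *
        ∏ i, ∏ j ∈ Finset.Ioi i, |Real.sinc (s * (Real.pi * (φ i - φ j)))|) := by
  rw [evalPhase_vandermondePoly, ← prod_prod_Ioi_const, ← prod_prod_Ioi_const, vandermondeProd]
  simp only [norm_prod, Finset.abs_prod, ← Finset.prod_mul_distrib]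
  refine Finset.prod_congr rfl fun i _ => Finset.prod_congr rfl fun j _ => ?_
  rw [norm_phase_sub, Pi.smul_apply, Pi.smul_apply, smul_eq_mul, smul_eq_mul, ← mul_sub, abs_mul,
    abs_of_nonneg hs, mul_left_comm Real.pi]
  ring

theorem tendsto_norm_evalPhase_vandermondePoly (φ : Fin k → ℝ) :
    Tendsto (fun t : ℕ => (t : ℝ) ^ (k * (k - 1) / 2) *
      ‖evalPhase (vandermondePoly k) ((t : ℝ)⁻¹ • φ)‖) atTop
      (𝓝 ((2 * Real.pi) ^ (k * (k - 1) / 2) * |vandermondeProd φ|)) := by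
  have h : Tendsto (fun s : ℝ => (2 * Real.pi) ^ (k * (k - 1) / 2) * |vandermondeProd φ| *
      ∏ i, ∏ j ∈ Finset.Ioi i, |Real.sinc (s * (Real.pi * (φ i - φ j)))|) (𝓝 0)
      (𝓝 ((2 * Real.pi) ^ (k * (k - 1) / 2) * |vandermondeProd φ|)) := by
    have hc : Continuous fun s : ℝ => (2 * Real.pi) ^ (k * (k - 1) / 2) * |vandermondeProd φ| *
        ∏ i, ∏ j ∈ Finset.Ioi i, |Real.sinc (s * (Real.pi * (φ i - φ j)))| := by
      refine continuous_const.mul (continuous_finsetProd _ fun i _ =>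
        continuous_finsetProd _ fun j _ => ?_)
      exact (Real.continuous_sinc.comp (by fun_prop)).abs
    simpa using hc.tendsto 0
  refine (h.comp tendsto_inv_atTop_nhds_zero_nat).congr' ?_
  filter_upwards [eventually_gt_atTop 0] with t ht
  have ht' : (t : ℝ) ≠ 0 := by positivity
  rw [norm_evalPhase_vandermondePoly_smul φ (by positivity), ← mul_assoc, ← mul_pow,
    mul_inv_cancel₀ ht', one_pow, one_mul, Function.comp_apply]

/-- Use `|a - b| ≤ (1 + |a|) (1 + |b|)`; each variable occurs in `k - 1` differences. -/
theorem abs_vandermondeProd_le (φ : Fin k → ℝ) :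
    |vandermondeProd φ| ≤ ∏ j, (1 + |φ j|) ^ k := by
  have h1 : |vandermondeProd φ| ≤ ∏ i, ∏ j ∈ Finset.Ioi i, ((1 + |φ i|) * (1 + |φ j|)) := by
    rw [vandermondeProd]
    simp only [Finset.abs_prod]
    refine Finset.prod_le_prod (fun _ _ => by positivity) fun i _ =>
      Finset.prod_le_prod (fun _ _ => by positivity) fun j _ => ?_
    have := mul_nonneg (abs_nonneg (φ i)) (abs_nonneg (φ j))
    linarith [abs_sub (φ i) (φ j)]
  refine h1.trans ?_
  have h2 : ∏ i : Fin k, ∏ j ∈ Finset.Ioi i, (1 + |φ j|) =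
      ∏ j : Fin k, ∏ _i ∈ Finset.Iio j, (1 + |φ j|) :=
    Finset.prod_comm' (by simp)
  simp only [Finset.prod_mul_distrib]
  rw [h2, ← Finset.prod_mul_distrib]
  simp only [Finset.prod_const]
  refine Finset.prod_le_prod (fun _ _ => by positivity) fun i _ => ?_
  rw [← pow_add]
  refine pow_le_pow_right₀ (le_add_of_nonneg_right (abs_nonneg (φ i))) ?_
  rw [Fin.card_Ioi, Fin.card_Iio]
  omega

theorem sq_norm_evalPhase_vandermondePoly_le (φ : Fin k → ℝ) {t : ℕ} (ht : 0 < t) :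
    ((t : ℝ) ^ (k * (k - 1) / 2) * ‖evalPhase (vandermondePoly k) ((t : ℝ)⁻¹ • φ)‖) ^ 2 ≤
      ((2 * Real.pi) ^ (k * (k - 1) / 2)) ^ 2 * ∏ j, (1 + |φ j|) ^ (2 * k) := by
  have ht' : (t : ℝ) ≠ 0 := by positivity
  rw [norm_evalPhase_vandermondePoly_smul φ (by positivity), ← mul_assoc, ← mul_pow,
    mul_inv_cancel₀ ht', one_pow, one_mul]
  simp only [mul_comm 2 k, pow_mul]
  rw [Finset.prod_pow, ← mul_pow, mul_assoc]
  refine pow_le_pow_left₀ (by positivity) ?_ 2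
  refine mul_le_mul_of_nonneg_left ?_ (by positivity)
  refine (mul_le_of_le_one_right (abs_nonneg _) ?_).trans (abs_vandermondeProd_le φ)
  refine Finset.prod_le_one (fun _ _ => by positivity) fun i _ =>
    Finset.prod_le_one (fun _ _ => by positivity) fun j _ => ?_
  exact Real.abs_sinc_le_one _

end Vandermonde


/-! ### Assembly of the two volume formulas -/

theorem two_mul_mul_pred_div_two (k : ℕ) : 2 * (k * (k - 1) / 2) = k * (k - 1) := by
  rw [← two_mul_sum_card_Ioi, Nat.mul_div_cancel_left _ two_pos]

theorem limitDensity_eq {n : ℕ} (k : ℕ) (z : ℂ) (φ : Fin n → ℝ) :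
    ‖z‖ ^ (2 * k) * ((2 * Real.pi) ^ (k * (k - 1) / 2) * |vandermondeProd φ|) ^ 2 =
      (2 * Real.pi) ^ (k * (k - 1)) * (‖z‖ ^ (2 * k) * vandermondeProd φ ^ 2) := by
  rw [mul_pow, sq_abs, ← pow_mul, mul_comm _ 2, two_mul_mul_pred_div_two]
  ring

theorem integrable_and_eq_of_const_mul {α : Type*} [MeasurableSpace α] {μ : Measure α}
    {f : α → ℝ} {c K v : ℝ} (hc : c ≠ 0) (hK : K ≠ 0)
    (h : Integrable (fun x => c * f x) μ ∧ ∫ x, c * f x ∂μ = K * v) :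
    Integrable f μ ∧ v = c / K * ∫ x, f x ∂μ := by
  refine ⟨(integrable_const_mul_iff hc.isUnit f).mp h.1, ?_⟩
  have h2 := h.2
  rw [integral_const_mul] at h2
  rw [div_mul_eq_mul_div, h2, mul_div_cancel_left₀ _ hK]

theorem volSubBirkhoff_eq_integral {k : ℕ} (hk : 1 ≤ k) :
    Integrable (subBirkhoffDensity k) ∧
      volSubBirkhoff k = (2 * Real.pi) ^ (k * (k - 1)) / (k.factorial : ℝ) *
        ∫ x : Fin k → ℝ, subBirkhoffDensity k x := by
  have hL : Tendsto (fun t : ℕ => ((boxCoeffSum t (completeHomogLE k t ^ k) : ℤ) : ℝ) /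
      (t : ℝ) ^ (k ^ 2)) atTop (𝓝 (volSubBirkhoff k)) := by
    refine (tendsto_ehrhart_subBirkhoff k).congr' ?_
    filter_upwards [eventually_gt_atTop 0] with t ht
    rw [← ehrhart_subBirkhoff ht, Int.cast_natCast]
  have hexp : k ^ 2 + k + 2 * (k * (k - 1) / 2) = 2 * k * k := by
    rw [two_mul_mul_pred_div_two, Nat.mul_sub, mul_one]
    have := Nat.le_mul_self k
    rw [sq, mul_assoc]
    omega
  -- Taking `N = k + 1` kernels per variable gives the damping exponent `2 (k + 1)` and the shift `q
  -- M` with `q = N`.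
  have h := integrable_and_integral_limitDensity (q := k + 1) hexp
    (continuous_evalPhase (vandermondePoly k)).norm (tendsto_norm_simplexExpSum k)
    tendsto_norm_evalPhase_vandermondePoly
    (fun t ht x => sq_norm_evalPhase_vandermondePoly_le x ht) hL
    (integral_simplexExpSum_subBirkhoff k) (subBirkhoff_smoothed_le k (k + 1))
  simp only [limitDensity_eq, ← norm_hInfty_cons_zero _ hk] at h
  exact integrable_and_eq_of_const_mul (by positivity) (by positivity) h

theorem volBirkhoff_succ_eq_integral {d : ℕ} (hd : 0 < d) :
    Integrable (birkhoffDensity (d + 1)) ∧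
      volBirkhoff (d + 1) / ((d : ℝ) + 1) ^ d =
        (2 * Real.pi) ^ ((d + 1) * d) / ((d + 1).factorial : ℝ) *
          ∫ x : Fin d → ℝ, birkhoffDensity (d + 1) x := by
  have hL : Tendsto (fun t : ℕ => ((magicCoeff (d + 1) t : ℤ) : ℝ) / (t : ℝ) ^ (d ^ 2)) atTop
      (𝓝 (volBirkhoff (d + 1) / ((d : ℝ) + 1) ^ d)) := by
    refine (tendsto_ehrhart_birkhoff_succ d).congr' ?_
    filter_upwards [eventually_gt_atTop 0] with t ht
    rw [← ehrhart_birkhoff ht, Int.cast_natCast]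
  have hexp : d ^ 2 + d + 2 * ((d + 1) * (d + 1 - 1) / 2) = 2 * (d + 1) * d := by
    rw [two_mul_mul_pred_div_two, Nat.add_sub_cancel]
    ring
  have hcons : ∀ (t : ℕ) (x : Fin d → ℝ), (Fin.cons 0 ((t : ℝ)⁻¹ • x) : Fin (d + 1) → ℝ) =
      (t : ℝ)⁻¹ • (Fin.cons 0 x : Fin (d + 1) → ℝ) := by
    intro t x
    ext i
    cases i using Fin.cases <;> simp
  -- Here `N = d + 2`, one more than `k = d + 1`, and the homogeneous smoothing shifts `t` by `2 k N
  -- M`.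
  have h := integrable_and_integral_limitDensity (q := 2 * ((d + 1) * (d + 1 + 1))) hexp
    (W := fun θ => ‖evalPhase (vandermondePoly (d + 1)) (Fin.cons 0 θ)‖)
    ((continuous_evalPhase (vandermondePoly (d + 1))).comp
      (continuous_const.finCons continuous_id)).norm (tendsto_norm_simplexExpSum d)
    (fun x => by
      simpa only [hcons] using tendsto_norm_evalPhase_vandermondePoly (Fin.cons 0 x))
    (fun t ht x => by
      -- The frozen coordinate `0` contributes a factor `1` to the growth bound.
      have := sq_norm_evalPhase_vandermondePoly_le (Fin.cons 0 x : Fin (d + 1) → ℝ) ht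
      rw [Fin.prod_univ_succ] at this
      simpa [hcons] using this) hL
    (integral_simplexExpSum_birkhoff (d := d))
    (fun M t hM => by
      have e : 2 * ((d + 1) * (d + 1 + 1)) * M = 2 * ((d + 1) * ((d + 1 + 1) * M)) := by ring
      rw [e] at hM ⊢
      exact birkhoff_smoothed_le (d := d) (d + 1 + 1) M t hM)
  simp only [limitDensity_eq, ← norm_hInfty_cons_zero _ hd] at h
  exact integrable_and_eq_of_const_mul (by positivity) (by positivity) h

theorem mainTheorem8 (k : ℕ) (hk : 1 ≤ k) :
    (Integrable (subBirkhoffDensity k) ∧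
      volSubBirkhoff k =
        (2 * Real.pi) ^ (k * (k - 1)) / (k.factorial : ℝ) *
          ∫ x : Fin k → ℝ, subBirkhoffDensity k x ∧
      Tendsto (fun t : ℕ => (ehrhart t (subBirkhoffPolytope k) : ℝ) / (t : ℝ) ^ (k ^ 2)) atTop
        (𝓝 ((2 * Real.pi) ^ (k * (k - 1)) / (k.factorial : ℝ) *
          ∫ x : Fin k → ℝ, subBirkhoffDensity k x))) ∧
    (2 ≤ k →
      Integrable (birkhoffDensity k) ∧
      volBirkhoff k / (k : ℝ) ^ (k - 1) =
        (2 * Real.pi) ^ (k * (k - 1)) / (k.factorial : ℝ) *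
          ∫ x : Fin (k - 1) → ℝ, birkhoffDensity k x ∧
      Tendsto (fun t : ℕ => (ehrhart t (birkhoffPolytope k) : ℝ) / (t : ℝ) ^ ((k - 1) ^ 2)) atTop
        (𝓝 ((2 * Real.pi) ^ (k * (k - 1)) / (k.factorial : ℝ) *
          ∫ x : Fin (k - 1) → ℝ, birkhoffDensity k x))) := by
  constructor
  · obtain ⟨hi, hv⟩ := volSubBirkhoff_eq_integral hk
    exact ⟨hi, hv, hv ▸ tendsto_ehrhart_subBirkhoff k⟩
  · intro hk2
    obtain ⟨d, rfl⟩ : ∃ d, k = d + 1 := ⟨k - 1, by omega⟩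
    obtain ⟨hi, hv⟩ := volBirkhoff_succ_eq_integral (d := d) (by omega)
    have hcast : ((d + 1 : ℕ) : ℝ) = (d : ℝ) + 1 := by push_cast; rfl
    refine ⟨hi, ?_, ?_⟩
    · rw [hcast]
      exact hv
    · have h := tendsto_ehrhart_birkhoff_succ d
      rw [hv] at h
      exact h

end
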